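/- Let $1\le p<\infty$, $C_\mu\ge 1$, $C>0$ and $\lambda\ge 1$. Then there are constants $C_m\ge 1$, $C'>0$ and $\lambda'\ge 1$, depending only on $p, C_\mu, C,\lambda$, such that the following holds. Let $(X,d,\mu)$ be a complete metric space with a nontrivial Borel regular measure $\mu$ such that every ball has positive and finite measure and $$\mu(B(x,2r))\le C_\mu\,\mu(B(x,r))\qquad (x\in X,\ r>0),$$ and suppose that $X$ supports a $(1,p)$-Poincaré inequality with constants $C,\lambda$: for every ball $B=B(x,r)$, every measurable $u:X\to\mathbb R$ that is integrable on balls and every upper gradient $\rho$ of $u$, $$\frac1{\mu(B)}\int_B|u-u_B|\,d\mu\le C\,r\left(\frac1{\mu(\lambda B)}\int_{\lambda B}\rho^p\,d\mu\right)^{1/p},$$ where $u_B=\frac1{\mu(B)}\int_B u\,d\mu$ and $\lambda B=B(x,\lambda r)$. Here a Borel function $\rho:X\to[0,\infty]$ is an upper gradient of $u$ if $|u(\gamma(a))-u(\gamma(b))|\le\int_\gamma\rho\,ds$ for every rectifiable path $\gamma:[a,b]\to X$. Let $\varepsilon>0$ and let $A\subset X$ be a maximal $\varepsilon$-separated set,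 i.e. distinct points of $A$ have distance at least $\varepsilon$ and every point of $X\setminus A$ has distance less than $\varepsilon$ to $A$. Let $V$ be the graph with one vertex for each point of $A$ (we identify vertices with points of $A$), where $x\sim y$ are joined by an edge if and only if $\varepsilon\le d(x,y)\le 3\varepsilon$. Let $d_V(x,y)$ be $\varepsilon$ times the least number of edges of a path from $x$ to $y$ in $V$, let $B_V(x,r)=\{y\in V: d_V(x,y)<r\}$, and let $m$ be the measure on $V$ with $m(\{x\})=\mu(B(x,\varepsilon))$. Then the graph $V$ is connected (so that $d_V$ is a metric), all balls $B_V(x,r)$ are finite, and 1. $m$ is doubling: it is nontrivial, $0<m(B_V(x,r))<\infty$ and $m(B_V(x,2r))\le C_m\,m(B_V(x,r))$ for all $x\in V$, $r>0$; 2. $V$ supports a discrete $(1,p)$-Poincaré inequality: for every $u:V\to\mathbb R$ and every ball $B=B_V(v,r)$, $v\in V$, $r>0$, with $\lambda'B=B_V(v,\lambda' r)$ and $u_B=\frac1{m(B)}\sum_{x\in B}u(x)\,m(\{x\})$, $$\frac1{m(B)}\sum_{x\in B}|u(x)-u_B|\,m(\{x\})\le C'\,r\left(\frac1{m(\lambda'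 B)}\sum_{x\in\lambda' B}\ \sum_{y\sim x}\frac{|u(x)-u(y)|^p}{\varepsilon^p}\,m(\{x\})\right)^{1/p}.$$ -/

import Mathlib

open MeasureTheory Set
open scoped ENNReal NNReal

noncomputable section

namespace Discretization

/-- `μ` is a doubling measure with constant `C` with respect to the balls `B x r`: it is nontrivial,
balls have positive and finite measure, and `μ (B x (2r)) ≤ C μ (B x r)`. -/
structure IsDoublingWith {α : Type*} [MeasurableSpace α] (B : α → ℝ → Set α) (μ : Measure α)
    (C : ℝ≥0) : Prop where
  one_le : 1 ≤ C
  ne_zero : μ ≠ 0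
  pos : ∀ x r, 0 < r → 0 < μ (B x r)
  finite : ∀ x r, 0 < r → μ (B x r) < ∞
  doubling : ∀ x r, 0 < r → μ (B x (2 * r)) ≤ C * μ (B x r)

section Continuous

variable {X : Type*} [MetricSpace X]

/-- The line integral `∫_γ ρ ds` of `ρ` along the rectifiable path `γ : [a, b] → X`, i.e. the
integral of `ρ` along the arc-length parametrization of `γ` over `[0, length γ]`. -/
def pathIntegral (ρ : X → ℝ≥0∞) (γ : ℝ → X) (a b : ℝ) : ℝ≥0∞ :=
  ∫⁻ t in Icc 0 (eVariationOn γ (Icc a b)).toReal, ρ (naturalParameterization γ (Icc a b) a t)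

variable [MeasurableSpace X]

/-- The Borel function `ρ : X → [0, ∞]` is an upper gradient of `u`. -/
def IsUpperGradient (u : X → ℝ) (ρ : X → ℝ≥0∞) : Prop :=
  Measurable ρ ∧ ∀ (a b : ℝ) (γ : ℝ → X), a ≤ b → ContinuousOn γ (Icc a b) →
    BoundedVariationOn γ (Icc a b) → ‖u (γ a) - u (γ b)‖ₑ ≤ pathIntegral ρ γ a b

/-- The `(1,p)`-Poincaré inequality with data `p, C, lam`. -/
def PoincareWith (μ : Measure X) (p : ℝ) (C : ℝ≥0) (lam : ℝ) : Prop :=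
  ∀ (u : X → ℝ) (ρ : X → ℝ≥0∞), Measurable u →
    (∀ x r, IntegrableOn u (Metric.ball x r) μ) → IsUpperGradient u ρ →
    ∀ (x : X) (r : ℝ), 0 < r →
      ⨍⁻ y in Metric.ball x r, ‖u y - ⨍ z in Metric.ball x r, u z ∂μ‖ₑ ∂μ ≤
        C * ENNReal.ofReal r * (⨍⁻ y in Metric.ball x (lam * r), ρ y ^ p ∂μ) ^ (1 / p)

end Continuous

section Discrete

variable {X : Type*} [MetricSpace X]

/-- `A` is a maximal `ε`-separated subset of `X`. -/
structure IsMaximalSeparated (ε : ℝ) (A : Set X) : Prop where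
  separated : ∀ x ∈ A, ∀ y ∈ A, x ≠ y → ε ≤ dist x y
  maximal : ∀ x, x ∉ A → ∃ a ∈ A, dist x a < ε

/-- The vertex set of the discretization: one vertex for each point of `A`. -/
def Vertex (A : Set X) : Type _ := A

/-- The point of `X` that corresponds to a vertex. -/
def Vertex.pt {A : Set X} (v : Vertex A) : X := Subtype.val v

/-- All sets of vertices are measurable. -/
instance (A : Set X) : MeasurableSpace (Vertex A) := ⊤

/-- Two vertices are joined by an edge iff the distance of the corresponding points lies in
`[ε, 3ε]`. (For `ε > 0` this forces the vertices to be distinct.) -/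
def graph (ε : ℝ) (A : Set X) : SimpleGraph (Vertex A) where
  Adj v w := v ≠ w ∧ ε ≤ dist v.pt w.pt ∧ dist v.pt w.pt ≤ 3 * ε
  symm := ⟨fun v w h => ⟨h.1.symm, by rw [dist_comm]; exact h.2⟩⟩
  loopless := ⟨fun _ h => h.1 rfl⟩

/-- The graph metric: `ε` times the least number of edges of a path from `v` to `w`.
(It is used for connected graphs only.) -/
def graphDist (ε : ℝ) (A : Set X) (v w : Vertex A) : ℝ := ε * ((graph ε A).dist v w : ℝ)

/-- Open balls of the graph metric. -/
def graphBall (ε : ℝ) (A : Set X) (v : Vertex A) (r : ℝ) : Set (Vertex A) :=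
  {w | graphDist ε A v w < r}

variable [MeasurableSpace X]

/-- The measure on vertices that gives the vertex at `x` the mass `μ (B (x, ε))`. -/
def vertexMeasure (μ : Measure X) (ε : ℝ) (A : Set X) : Measure (Vertex A) :=
  Measure.sum fun v => μ (Metric.ball v.pt ε) • Measure.dirac v

theorem vertexMeasure_apply (μ : Measure X) (ε : ℝ) (A : Set X) (W : Set (Vertex A)) :
    vertexMeasure μ ε A W = ∑' w : W, μ (Metric.ball w.1.pt ε) := by
  classical
  rw [vertexMeasure, Measure.sum_apply _ (MeasurableSpace.measurableSet_top),
    tsum_subtype W fun w : Vertex A => μ (Metric.ball w.pt ε)]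
  refine tsum_congr fun v => ?_
  rw [Measure.smul_apply, Measure.dirac_apply' _ (MeasurableSpace.measurableSet_top)]
  by_cases h : v ∈ W <;> simp [h]

/-- The discrete `(1,p)`-Poincaré inequality with data `p, C, lam`. -/
def DiscretePoincareWith (μ : Measure X) (ε : ℝ) (A : Set X) (p : ℝ) (C : ℝ≥0) (lam : ℝ) : Prop :=
  ∀ (u : Vertex A → ℝ) (v : Vertex A) (r : ℝ), 0 < r →
    ⨍⁻ x in graphBall ε A v r,
        ‖u x - ⨍ z in graphBall ε A v r, u z ∂(vertexMeasure μ ε A)‖ₑ ∂(vertexMeasure μ ε A) ≤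
      C * ENNReal.ofReal r *
        (⨍⁻ x in graphBall ε A v (lam * r),
          (∑' y : (graph ε A).neighborSet x, ‖u x - u y‖ₑ ^ p / ENNReal.ofReal ε ^ p)
            ∂(vertexMeasure μ ε A)) ^ (1 / p)

end Discrete

end Discretization

end

namespace Discretization

open Filter Topology

/-! ### Rectifiable paths and upper gradients of locally Lipschitz functions. -/

section Paths

/-! A function `u` on the vertices extends to `X` by a Lipschitz partition of unity (`extension`).
On the ball `B(v, ε)` the extension only involves `v` and its neighbours. Hence it stays within the
largest edge difference of `u` at `v` from `u v`, and it is Lipschitz there with a constant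
comparable to that difference divided by `ε`. Bounds on edge differences therefore give upper
gradients (`isUpperGradient_extension`), and the Poincaré inequality of `X` becomes a statement
about `u`.

It is used twice. First, let all edge differences be at most `δ`. Telescoping the averages of the
extension over the balls `B(v, 2^k ε)` gives `|u v - u w| ≤ K 2^k δ` whenever `d(v, w) < 2^k ε`
(`abs_sub_le_of_adj_le`). With `δ = 0` and `u` the indicator of a component, this is connectedness.
With `δ = 1` and `u` the combinatorial distance from a vertex, it bounds `d_V` by a multiple of `d`
at scales at least `ε`. The converse `d ≤ 3 d_V` follows by summing along walks. So balls of the two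
metrics are nested up to constant factors, bounded overlap compares `m` with `μ`, and doubling of
`μ` passes to `m`.

Second, for general `u`, an upper gradient is a constant times the `1/p`-th power of the sum of the
vertex energies, each spread over `B(v, ε)`. The Poincaré inequality for the extension on `B(v, 4r)`
bounds its oscillation by the discrete energy. Replacing the extension by `u` costs `ε` times the
average of the `1/p`-th power of the energy, controlled by Jensen's inequality and `ε < r`. For `r ≤
ε` the graph ball is a single vertex. -/

theorem continuousOn_variationOnFromTo {E : Type*} [PseudoMetricSpace E] {f : ℝ → E} {s : Set ℝ}
    (hf : LocallyBoundedVariationOn f s) (hc : ContinuousOn f s) {a : ℝ} (ha : a ∈ s) :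
    ContinuousOn (variationOnFromTo f s a) s := by
  intro b hb
  -- The one-sided limits of the variation differ from its value by the jumps of `f`, which vanish
  -- by continuity.
  have hl := variationOnFromTo.tendsto_left ha hb hf
    ((hc b hb).mono_left (nhdsWithin_mono _ inter_subset_left))
  have hr := variationOnFromTo.tendsto_right ha hb hf
    ((hc b hb).mono_left (nhdsWithin_mono _ inter_subset_left))
  simp only [dist_self, sub_zero, add_zero] at hl hr
  have hs : s ⊆ ((s ∩ Iio b) ∪ (s ∩ Ioi b)) ∪ {b} := by
    intro x hx
    rcases lt_trichotomy x b with h | h | h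
    · exact Or.inl (Or.inl ⟨hx, h⟩)
    · exact Or.inr h
    · exact Or.inl (Or.inr ⟨hx, h⟩)
  refine ContinuousWithinAt.mono ?_ hs
  exact (ContinuousWithinAt.union hl hr).union continuousWithinAt_singleton

variable {X : Type*} [MetricSpace X]

/-- The natural parametrization of a rectifiable path is `1`-Lipschitz on `[0, length]`. -/
theorem edist_naturalParameterization_le {γ : ℝ → X} {a b : ℝ} (hab : a ≤ b)
    (hc : ContinuousOn γ (Icc a b)) (hv : BoundedVariationOn γ (Icc a b)) {s t : ℝ}
    (hs : s ∈ Icc 0 (eVariationOn γ (Icc a b)).toReal)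
    (ht : t ∈ Icc 0 (eVariationOn γ (Icc a b)).toReal) (hst : s ≤ t) :
    edist (naturalParameterization γ (Icc a b) a s) (naturalParameterization γ (Icc a b) a t) ≤
      ENNReal.ofReal (t - s) := by
  have ha : a ∈ Icc a b := left_mem_Icc.2 hab
  have hlv := hv.locallyBoundedVariationOn
  -- The variation function is continuous, so it attains every value in `[0, length]`; the unit
  -- speed property is only available at attained values.
  have himage : Icc 0 (eVariationOn γ (Icc a b)).toReal ⊆
      variationOnFromTo γ (Icc a b) a '' Icc a b := by
    have h := intermediate_value_Icc hab (continuousOn_variationOnFromTo hlv hc ha)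
    rwa [variationOnFromTo.self, variationOnFromTo.eq_of_le _ _ hab, inter_self] at h
  have hu := has_unit_speed_naturalParameterization γ hlv ha (himage hs) (himage ht)
  rw [NNReal.coe_one, one_mul] at hu
  rw [← hu]
  exact eVariationOn.edist_le _ ⟨himage hs, le_rfl, hst⟩ ⟨himage ht, hst, le_rfl⟩

theorem naturalParameterization_zero {γ : ℝ → X} {a b : ℝ} (hab : a ≤ b)
    (hv : BoundedVariationOn γ (Icc a b)) :
    naturalParameterization γ (Icc a b) a 0 = γ a := by
  have ha : a ∈ Icc a b := left_mem_Icc.2 hab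
  have h := edist_naturalParameterization_eq_zero hv.locallyBoundedVariationOn ha ha
  rwa [variationOnFromTo.self, edist_eq_zero] at h

theorem naturalParameterization_length {γ : ℝ → X} {a b : ℝ} (hab : a ≤ b)
    (hv : BoundedVariationOn γ (Icc a b)) :
    naturalParameterization γ (Icc a b) a (eVariationOn γ (Icc a b)).toReal = γ b := by
  have h := edist_naturalParameterization_eq_zero hv.locallyBoundedVariationOn
    (left_mem_Icc.2 hab) (right_mem_Icc.2 hab)
  rwa [variationOnFromTo.eq_of_le _ _ hab, inter_self, edist_eq_zero] at h

/-- If `u` is `L i`-Lipschitz on the `i`-th set of an open cover and `ρ ≥ L i` there, then `ρ` is an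
upper gradient of `u`. -/
theorem isUpperGradient_of_open_cover [MeasurableSpace X] {ι : Type*} {U : ι → Set X}
    (hU : ∀ i, IsOpen (U i)) (hcover : ∀ x, ∃ i, x ∈ U i) {u : X → ℝ} {L : ι → ℝ≥0∞}
    (hL : ∀ i, ∀ x ∈ U i, ∀ y ∈ U i, ‖u x - u y‖ₑ ≤ L i * edist x y) {ρ : X → ℝ≥0∞}
    (hρ : Measurable ρ) (hLρ : ∀ i, ∀ x ∈ U i, L i ≤ ρ x) : IsUpperGradient u ρ := by
  refine ⟨hρ, fun a b γ hab hc hv => ?_⟩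
  rw [pathIntegral]
  have hlip := fun s t => edist_naturalParameterization_le hab hc hv (s := s) (t := t)
  rw [← naturalParameterization_length hab hv]
  nth_rewrite 1 [← naturalParameterization_zero hab hv]
  set c := naturalParameterization γ (Icc a b) a
  set l := (eVariationOn γ (Icc a b)).toReal
  have hl : 0 ≤ l := ENNReal.toReal_nonneg
  have hcont : Continuous fun t : Icc 0 l => c t := by
    refine LipschitzWith.continuous (K := 1) fun s t => ?_
    rw [ENNReal.coe_one, one_mul]
    rcases le_total s t with h | h
    · refine (hlip s t s.2 t.2 h).trans ?_
      rw [Subtype.edist_eq, edist_comm, edist_dist, Real.dist_eq]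
      exact ENNReal.ofReal_le_ofReal (le_abs_self _)
    · rw [edist_comm]
      refine (hlip t s t.2 s.2 h).trans ?_
      rw [Subtype.edist_eq, edist_dist, Real.dist_eq]
      exact ENNReal.ofReal_le_ofReal (le_abs_self _)
  -- Compactness gives a finite partition with each piece mapped into one set of the cover; the
  -- Lipschitz estimates are then added along it.
  obtain ⟨t, ht0, htm, ⟨m, hm⟩, ht⟩ := exists_monotone_Icc_subset_open_cover_Icc hl
    (c := fun i => (fun t : Icc 0 l => c t) ⁻¹' U i) (fun i => (hU i).preimage hcont)
    (fun s _ => by simpa using hcover (c s))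
  have key : ∀ n, ‖u (c 0) - u (c (t n))‖ₑ ≤ ∫⁻ s in Icc 0 (t n : ℝ), ρ (c s) := by
    intro n
    induction n with
    | zero => simp [ht0]
    | succ n ih =>
      obtain ⟨i, hi⟩ := ht n
      have hle : (t n : ℝ) ≤ t (n + 1) := htm n.le_succ
      have hmem : ∀ s ∈ Icc (t n : ℝ) (t (n + 1)), c s ∈ U i := fun s hs =>
        hi (show (⟨s, (t n).2.1.trans hs.1, hs.2.trans (t (n + 1)).2.2⟩ : Icc 0 l) ∈ _ from hs)
      have hstep : ‖u (c (t n)) - u (c (t (n + 1)))‖ₑ ≤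
          ∫⁻ s in Ioc (t n : ℝ) (t (n + 1)), ρ (c s) :=
        calc ‖u (c (t n)) - u (c (t (n + 1)))‖ₑ
            ≤ L i * edist (c (t n)) (c (t (n + 1))) :=
              hL i _ (hmem _ (left_mem_Icc.2 hle)) _ (hmem _ (right_mem_Icc.2 hle))
          _ ≤ L i * ENNReal.ofReal (t (n + 1) - t n) := by
              gcongr
              exact hlip _ _ (t n).2 (t (n + 1)).2 hle
          _ = ∫⁻ _ in Ioc (t n : ℝ) (t (n + 1)), L i := by
              rw [setLIntegral_const, Real.volume_Ioc]
          _ ≤ _ := setLIntegral_mono' measurableSet_Ioc fun s hs =>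
              hLρ i _ (hmem s (Ioc_subset_Icc_self hs))
      have hunion : Icc 0 (t (n + 1) : ℝ) = Icc 0 (t n : ℝ) ∪ Ioc (t n : ℝ) (t (n + 1)) :=
        (Icc_union_Ioc_eq_Icc (t n).2.1 hle).symm
      have hdisj : Disjoint (Icc 0 (t n : ℝ)) (Ioc (t n : ℝ) (t (n + 1))) :=
        Set.disjoint_left.2 fun s hs hs' => absurd hs'.1 (not_lt.2 hs.2)
      rw [hunion, lintegral_union measurableSet_Ioc hdisj]
      refine le_trans ?_ (add_le_add ih hstep)
      rw [← sub_add_sub_cancel (u (c 0)) (u (c (t n))) (u (c (t (n + 1))))]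
      exact enorm_add_le _ _
  have h := key m
  rwa [hm m le_rfl] at h

end Paths

/-! ### Comparison of averages. -/

section Averages

variable {α : Type*} [MeasurableSpace α] {μ : Measure α}

/-- Enlarging the domain of integration increases the integral of `|f - c|`, while the normalization
changes by a factor of at most `D`. -/
theorem enorm_setAverage_sub_le {s t : Set α} (hst : s ⊆ t) (hs : μ s ≠ 0) (ht : μ t ≠ ∞)
    {D : ℝ≥0∞} (hD : μ t ≤ D * μ s) {f : α → ℝ} (hf : IntegrableOn f s μ) (c : ℝ) :
    ‖(⨍ x in s, f x ∂μ) - c‖ₑ ≤ D * ⨍⁻ x in t, ‖f x - c‖ₑ ∂μ := by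
  have hs' : μ s ≠ ∞ := ne_top_of_le_ne_top ht (measure_mono hst)
  have ht' : μ t ≠ 0 := fun h => hs (measure_mono_null hst h)
  have havg : (⨍ x in s, f x ∂μ) - c = ⨍ x in s, (f x - c) ∂μ := by
    rw [setAverage_eq, setAverage_eq, integral_sub hf (integrableOn_const hs'),
      setIntegral_const, smul_sub, smul_smul, inv_mul_cancel₀, one_smul]
    exact (ENNReal.toReal_pos hs hs').ne'
  have hle : ‖⨍ x in s, (f x - c) ∂μ‖ₑ ≤ (∫⁻ x in s, ‖f x - c‖ₑ ∂μ) / μ s := by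
    rw [setAverage_eq, enorm_smul, ENNReal.div_eq_inv_mul]
    have h1 : ‖(μ.real s)⁻¹‖ₑ = (μ s)⁻¹ := by
      rw [Real.enorm_eq_ofReal (by positivity), Measure.real,
        ENNReal.ofReal_inv_of_pos (ENNReal.toReal_pos hs hs'), ENNReal.ofReal_toReal hs']
    rw [h1]
    gcongr
    exact enorm_integral_le_lintegral_enorm _
  rw [havg]
  refine hle.trans ?_
  rw [setLAverage_eq, ENNReal.div_le_iff hs hs', ENNReal.div_eq_inv_mul]
  calc ∫⁻ x in s, ‖f x - c‖ₑ ∂μ ≤ ∫⁻ x in t, ‖f x - c‖ₑ ∂μ := lintegral_mono_set hst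
    _ = (μ t)⁻¹ * μ t * ∫⁻ x in t, ‖f x - c‖ₑ ∂μ := by rw [ENNReal.inv_mul_cancel ht' ht, one_mul]
    _ ≤ (μ t)⁻¹ * (D * μ s) * ∫⁻ x in t, ‖f x - c‖ₑ ∂μ := by gcongr
    _ = _ := by ring

/-- The mean is within the average of `|f - c|` of `c`. This allows the discrete mean to be replaced
by a mean of the extension. -/
theorem setLAverage_sub_setAverage_le {s : Set α} (hs : μ s ≠ 0) (hs' : μ s ≠ ∞)
    {f : α → ℝ} (hf : IntegrableOn f s μ) (c : ℝ) :
    ⨍⁻ x in s, ‖f x - ⨍ z in s, f z ∂μ‖ₑ ∂μ ≤ 2 * ⨍⁻ x in s, ‖f x - c‖ₑ ∂μ := by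
  have h := enorm_setAverage_sub_le Subset.rfl hs hs' (D := 1) (by simp) hf c
  rw [one_mul] at h
  have hconst : ⨍⁻ _ in s, ‖(⨍ z in s, f z ∂μ) - c‖ₑ ∂μ = ‖(⨍ z in s, f z ∂μ) - c‖ₑ := by
    rw [setLAverage_eq, setLIntegral_const, ENNReal.mul_div_cancel_right hs hs']
  calc ⨍⁻ x in s, ‖f x - ⨍ z in s, f z ∂μ‖ₑ ∂μ
      ≤ ⨍⁻ x in s, (‖f x - c‖ₑ + ‖(⨍ z in s, f z ∂μ) - c‖ₑ) ∂μ := by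
        refine lintegral_mono fun x => ?_
        rw [← sub_sub_sub_cancel_right _ _ c]
        exact enorm_sub_le
    _ = ⨍⁻ x in s, ‖f x - c‖ₑ ∂μ + ⨍⁻ _ in s, ‖(⨍ z in s, f z ∂μ) - c‖ₑ ∂μ := by
        rw [setLAverage_eq, setLAverage_eq, setLAverage_eq,
          lintegral_add_right _ measurable_const, ENNReal.add_div]
    _ ≤ _ := by rw [hconst, two_mul]; gcongr

/-- Jensen's inequality for the power `1 / p`, `p ≥ 1`. -/
theorem setLAverage_rpow_le {s : Set α} (hs : μ s ≠ 0) (hs' : μ s ≠ ∞) {p : ℝ} (hp : 1 ≤ p)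
    {f : α → ℝ≥0∞} (hf : Measurable f) :
    ⨍⁻ x in s, f x ^ (1 / p) ∂μ ≤ (⨍⁻ x in s, f x ∂μ) ^ (1 / p) := by
  have hp0 : 0 < p := by linarith
  have : IsProbabilityMeasure ((μ.restrict s univ)⁻¹ • μ.restrict s) := by
    constructor
    rw [Measure.smul_apply, smul_eq_mul, Measure.restrict_apply_univ, ENNReal.inv_mul_cancel hs hs']
  have h := eLpNorm'_le_eLpNorm'_of_exponent_le (p := 1) (q := p) one_pos hp
    ((μ.restrict s univ)⁻¹ • μ.restrict s) (f := fun x => f x ^ (1 / p))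
    (hf.pow_const _).aestronglyMeasurable
  simpa [eLpNorm', laverage, ← ENNReal.rpow_mul, inv_mul_cancel₀ hp0.ne'] using h

end Averages

theorem exists_dist_lt {X : Type*} [MetricSpace X] {ε : ℝ} {A : Set X} (hε : 0 < ε)
    (hA : IsMaximalSeparated ε A) (x : X) : ∃ v : Vertex A, dist x v.pt < ε := by
  by_cases hx : x ∈ A
  · exact ⟨⟨x, hx⟩, by simpa [Vertex.pt] using hε⟩
  · obtain ⟨a, ha, h⟩ := hA.maximal x hx
    exact ⟨⟨a, ha⟩, h⟩

/-! ### Packing bounds from doubling. -/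

section Doubling

variable {X : Type*} [MetricSpace X] [MeasurableSpace X] {μ : Measure X} {D : ℝ≥0}

theorem IsDoublingWith.measure_ball_le (hμ : IsDoublingWith Metric.ball μ D) {x y : X} {r R : ℝ}
    (hr : 0 < r) (n : ℕ) (h : R + dist x y ≤ 2 ^ n * r) :
    μ (Metric.ball x R) ≤ D ^ n * μ (Metric.ball y r) := by
  have key : ∀ n : ℕ, μ (Metric.ball y (2 ^ n * r)) ≤ D ^ n * μ (Metric.ball y r) := by
    intro n
    induction n with
    | zero => simp
    | succ n ih =>
      rw [pow_succ', mul_assoc, pow_succ', mul_assoc]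
      exact (hμ.doubling y _ (by positivity)).trans (by gcongr)
  exact (measure_mono (Metric.ball_subset_ball' h)).trans (key n)

variable [OpensMeasurableSpace X] {ε : ℝ} {A : Set X}

/-- Volume packing: the balls `B(v, ε/2)` are disjoint and lie in `B(x, R + ε/2)`, and each carries
at least the fraction `D ^ (-n)` of its mass, since `2R + ε/2 ≤ 2^n (ε/2)`. -/
theorem card_le_of_separated (hμ : IsDoublingWith Metric.ball μ D) (hε : 0 < ε)
    (hA : IsMaximalSeparated ε A) {x : X} {R : ℝ} (n : ℕ) (hn : 4 * R + ε ≤ 2 ^ n * ε)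
    (F : Finset (Vertex A)) (hF : ∀ v ∈ F, dist v.pt x < R) : (F.card : ℝ≥0) ≤ D ^ n := by
  rcases F.eq_empty_or_nonempty with rfl | ⟨v₀, hv₀⟩
  · simp
  have hR : 0 < R := dist_nonneg.trans_lt (hF v₀ hv₀)
  have hpos := hμ.pos x (R + ε / 2) (by positivity)
  have hfin := hμ.finite x (R + ε / 2) (by positivity)
  have hdisj : (F : Set (Vertex A)).PairwiseDisjoint fun v => Metric.ball v.pt (ε / 2) := by
    intro v _ w _ hvw
    refine Metric.ball_disjoint_ball ?_
    rw [add_halves]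
    exact hA.separated _ v.2 _ w.2 fun h => hvw (Subtype.ext h)
  have hsub : (⋃ v ∈ F, Metric.ball v.pt (ε / 2)) ⊆ Metric.ball x (R + ε / 2) := by
    refine iUnion₂_subset fun v hv => Metric.ball_subset_ball' ?_
    linarith [hF v hv]
  have h1 : ∑ v ∈ F, μ (Metric.ball v.pt (ε / 2)) ≤ μ (Metric.ball x (R + ε / 2)) := by
    rw [← measure_biUnion_finset hdisj fun _ _ => Metric.isOpen_ball.measurableSet]
    exact measure_mono hsub
  have h2 : (F.card : ℝ≥0∞) * μ (Metric.ball x (R + ε / 2)) ≤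
      D ^ n * μ (Metric.ball x (R + ε / 2)) :=
    calc (F.card : ℝ≥0∞) * μ (Metric.ball x (R + ε / 2))
        = ∑ v ∈ F, μ (Metric.ball x (R + ε / 2)) := by simp
      _ ≤ ∑ v ∈ F, D ^ n * μ (Metric.ball v.pt (ε / 2)) := by
          refine Finset.sum_le_sum fun v hv => hμ.measure_ball_le (by positivity) n ?_
          rw [dist_comm]
          linarith [hF v hv]
      _ ≤ _ := by rw [← Finset.mul_sum]; gcongr
  have h3 := (ENNReal.mul_le_mul_iff_left hpos.ne' hfin.ne).1 h2
  exact_mod_cast h3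

theorem finite_setOf_dist_lt (hμ : IsDoublingWith Metric.ball μ D) (hε : 0 < ε)
    (hA : IsMaximalSeparated ε A) (x : X) (R : ℝ) : {v : Vertex A | dist v.pt x < R}.Finite := by
  obtain ⟨n, hn⟩ := pow_unbounded_of_one_lt ((4 * R + ε) / ε) (one_lt_two (α := ℝ))
  rw [div_lt_iff₀ hε] at hn
  by_contra hinf
  obtain ⟨m, hm⟩ := exists_nat_gt (D ^ n)
  obtain ⟨F, hF, hcard⟩ := Set.Infinite.exists_subset_card_eq hinf m
  have h := card_le_of_separated hμ hε hA n hn.le F fun v hv => hF hv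
  rw [hcard] at h
  exact absurd hm (not_lt.2 h)

theorem countable_vertex (hμ : IsDoublingWith Metric.ball μ D) (hε : 0 < ε)
    (hA : IsMaximalSeparated ε A) : Countable (Vertex A) := by
  rcases isEmpty_or_nonempty X with hX | ⟨⟨x⟩⟩
  · exact ⟨⟨fun v => (hX.false v.pt).elim, fun v => (hX.false v.pt).elim⟩⟩
  have h : (univ : Set (Vertex A)) ⊆ ⋃ n : ℕ, {v | dist v.pt x < n} := fun v _ =>
    mem_iUnion.2 (exists_nat_gt (dist v.pt x))
  exact countable_univ_iff.1
    ((countable_iUnion fun n : ℕ => (finite_setOf_dist_lt hμ hε hA x n).countable).mono h)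

end Doubling

/-! ### Comparison of integrals over the vertices and over `X`. -/

section VertexMeasure

variable {X : Type*} [MetricSpace X] [MeasurableSpace X] {μ : Measure X} {D : ℝ≥0} {ε : ℝ}
  {A : Set X}

theorem setLIntegral_vertexMeasure (F : Finset (Vertex A)) (f : Vertex A → ℝ≥0∞) :
    ∫⁻ v in F, f v ∂(vertexMeasure μ ε A) = ∑ v ∈ F, μ (Metric.ball v.pt ε) * f v := by
  have hmeas : ∀ g : Vertex A → ℝ≥0∞, Measurable g := fun g => measurable_from_top
  rw [← lintegral_indicator (MeasurableSpace.measurableSet_top), vertexMeasure,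
    lintegral_sum_measure, tsum_eq_sum (s := F)]
  · refine Finset.sum_congr rfl fun v hv => ?_
    rw [lintegral_smul_measure, lintegral_dirac' _ (hmeas _), indicator_of_mem (by exact hv),
      smul_eq_mul]
  · intro v hv
    rw [lintegral_smul_measure, lintegral_dirac' _ (hmeas _), indicator_of_notMem (by exact hv),
      smul_zero]

theorem vertexMeasure_finset (F : Finset (Vertex A)) :
    vertexMeasure μ ε A F = ∑ v ∈ F, μ (Metric.ball v.pt ε) := by
  rw [← setLIntegral_one, setLIntegral_vertexMeasure]
  simp

theorem vertexMeasure_singleton (v : Vertex A) :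
    vertexMeasure μ ε A {v} = μ (Metric.ball v.pt ε) := by
  simpa using vertexMeasure_finset (μ := μ) (ε := ε) {v}

theorem integrableOn_vertexMeasure {W : Set (Vertex A)} (hW : W.Finite)
    (hWm : vertexMeasure μ ε A W ≠ ∞) (u : Vertex A → ℝ) :
    IntegrableOn u W (vertexMeasure μ ε A) := by
  obtain ⟨K, hK⟩ := (hW.image fun v => ‖u v‖).bddAbove
  have hu : Measurable u := measurable_from_top
  refine Measure.integrableOn_of_bounded (M := K) hWm hu.aestronglyMeasurable ?_
  exact (ae_restrict_iff' MeasurableSpace.measurableSet_top).2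
    (ae_of_all _ fun v hv => hK (mem_image_of_mem _ hv))

variable [OpensMeasurableSpace X]

/-- Bounded overlap of the balls around the vertices. -/
theorem sum_setLIntegral_ball_le (hμ : IsDoublingWith Metric.ball μ D) (hε : 0 < ε)
    (hA : IsMaximalSeparated ε A) {s : Set X} (hs : MeasurableSet s) (F : Finset (Vertex A))
    (hF : ∀ v ∈ F, Metric.ball v.pt ε ⊆ s) {g : X → ℝ≥0∞} (hg : Measurable g) :
    ∑ v ∈ F, ∫⁻ y in Metric.ball v.pt ε, g y ∂μ ≤ D ^ 4 * ∫⁻ y in s, g y ∂μ := by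
  classical
  have hmeas : ∀ v ∈ F, Measurable ((Metric.ball v.pt ε).indicator g) := fun v _ =>
    hg.indicator Metric.isOpen_ball.measurableSet
  calc ∑ v ∈ F, ∫⁻ y in Metric.ball v.pt ε, g y ∂μ
      = ∫⁻ y, ∑ v ∈ F, (Metric.ball v.pt ε).indicator g y ∂μ := by
        rw [lintegral_finsetSum _ hmeas]
        exact Finset.sum_congr rfl fun v _ =>
          (lintegral_indicator Metric.isOpen_ball.measurableSet _).symm
    _ ≤ ∫⁻ y, s.indicator (fun y => D ^ 4 * g y) y ∂μ := by
        refine lintegral_mono fun y => ?_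
        by_cases hy : y ∈ s
        · rw [indicator_of_mem hy]
          -- The exponent `4` comes from `4ε + ε ≤ 2^4 ε`.
          have hcard := card_le_of_separated hμ hε hA (x := y) (R := ε) 4 (by linarith)
            (F.filter fun v => dist v.pt y < ε) (fun v hv => (Finset.mem_filter.1 hv).2)
          have hcard' : ((F.filter fun v => dist v.pt y < ε).card : ℝ≥0∞) ≤ D ^ 4 := by
            exact_mod_cast hcard
          calc ∑ v ∈ F, (Metric.ball v.pt ε).indicator g y
              = ∑ v ∈ F, if dist v.pt y < ε then g y else 0 := by
                refine Finset.sum_congr rfl fun v _ => ?_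
                simp only [indicator_apply, Metric.mem_ball, dist_comm y]
            _ = (F.filter fun v => dist v.pt y < ε).card * g y := by
                rw [← Finset.sum_filter, Finset.sum_const, nsmul_eq_mul]
            _ ≤ _ := by gcongr
        · rw [indicator_of_notMem hy, nonpos_iff_eq_zero]
          exact Finset.sum_eq_zero fun v hv => indicator_of_notMem (fun h => hy (hF v hv h)) _
    _ = D ^ 4 * ∫⁻ y in s, g y ∂μ := by
        rw [lintegral_indicator hs, lintegral_const_mul _ hg]

theorem vertexMeasure_le (hμ : IsDoublingWith Metric.ball μ D) (hε : 0 < ε)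
    (hA : IsMaximalSeparated ε A) (x : X) (R : ℝ) :
    vertexMeasure μ ε A {v | dist v.pt x < R} ≤ D ^ 4 * μ (Metric.ball x (R + ε)) := by
  lift {v : Vertex A | dist v.pt x < R} to Finset (Vertex A) using
    finite_setOf_dist_lt hμ hε hA x R with F hF
  have hF' : ∀ v ∈ F, dist v.pt x < R := fun v hv => by
    have : v ∈ (F : Set (Vertex A)) := hv
    rwa [hF] at this
  rw [vertexMeasure_finset]
  have h := sum_setLIntegral_ball_le hμ hε hA (s := Metric.ball x (R + ε))
    Metric.isOpen_ball.measurableSet F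
    (fun v hv => Metric.ball_subset_ball' (by linarith [hF' v hv])) (g := fun _ => 1)
    measurable_const
  simpa using h

theorem measure_ball_le_vertexMeasure (hμ : IsDoublingWith Metric.ball μ D) (hε : 0 < ε)
    (hA : IsMaximalSeparated ε A) (x : X) (R : ℝ) :
    μ (Metric.ball x R) ≤ vertexMeasure μ ε A {v | dist v.pt x < R + ε} := by
  have hfin := finite_setOf_dist_lt hμ hε hA x (R + ε)
  rw [← hfin.coe_toFinset, vertexMeasure_finset]
  refine (measure_mono ?_).trans (measure_biUnion_finset_le _ _)
  intro y hy
  obtain ⟨v, hv⟩ := exists_dist_lt hε hA y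
  refine mem_iUnion₂.2 ⟨v, ?_, hv⟩
  rw [Set.Finite.mem_toFinset, mem_ofPred_eq]
  rw [Metric.mem_ball] at hy
  linarith [dist_triangle v.pt y x, dist_comm v.pt y]

/-- Only vertices within `R + ε` of `x` contribute on the ball, and each indicator integrates to at
most the mass of its vertex. No overlap constant arises. -/
theorem setLIntegral_tsum_indicator_ball_le (hμ : IsDoublingWith Metric.ball μ D) (hε : 0 < ε)
    (hA : IsMaximalSeparated ε A) (x : X) (R : ℝ) (c : Vertex A → ℝ≥0∞) :
    ∫⁻ y in Metric.ball x R, ∑' v, (Metric.ball v.pt ε).indicator (fun _ => c v) y ∂μ ≤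
      ∫⁻ v in {v | dist v.pt x < R + ε}, c v ∂(vertexMeasure μ ε A) := by
  have hfin := finite_setOf_dist_lt hμ hε hA x (R + ε)
  have hmeas : ∀ v : Vertex A, Measurable ((Metric.ball v.pt ε).indicator fun _ : X => c v) :=
    fun v => measurable_const.indicator Metric.isOpen_ball.measurableSet
  rw [← hfin.coe_toFinset, setLIntegral_vertexMeasure]
  calc ∫⁻ y in Metric.ball x R, ∑' v, (Metric.ball v.pt ε).indicator (fun _ => c v) y ∂μ
      ≤ ∫⁻ y in Metric.ball x R,
          ∑ v ∈ hfin.toFinset, (Metric.ball v.pt ε).indicator (fun _ => c v) y ∂μ := by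
        refine setLIntegral_mono' Metric.isOpen_ball.measurableSet fun y hy => le_of_eq ?_
        refine tsum_eq_sum fun v hv => indicator_of_notMem (fun hyv => hv ?_) _
        rw [Set.Finite.mem_toFinset, mem_ofPred_eq]
        rw [Metric.mem_ball] at hy hyv
        linarith [dist_triangle v.pt y x, dist_comm v.pt y]
    _ ≤ ∫⁻ y, ∑ v ∈ hfin.toFinset, (Metric.ball v.pt ε).indicator (fun _ => c v) y ∂μ :=
        setLIntegral_le_lintegral _ _
    _ = ∑ v ∈ hfin.toFinset, μ (Metric.ball v.pt ε) * c v := by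
        rw [lintegral_finsetSum _ fun v _ => hmeas v]
        refine Finset.sum_congr rfl fun v _ => ?_
        rw [lintegral_indicator_const Metric.isOpen_ball.measurableSet, mul_comm]

end VertexMeasure

/-! ### Stability of weighted means under change of weights. -/

section WeightedMean

variable {ι : Type*} {S : Finset ι} {f g w : ι → ℝ} {M : ℝ}

theorem abs_sum_mul_div_sum_le (hf : ∀ i ∈ S, 0 ≤ f i) (hpos : 0 < ∑ i ∈ S, f i)
    (hw : ∀ i ∈ S, |w i| ≤ M) : |(∑ i ∈ S, f i * w i) / ∑ i ∈ S, f i| ≤ M := by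
  rw [abs_div, abs_of_pos hpos, div_le_iff₀ hpos, Finset.mul_sum]
  refine (Finset.abs_sum_le_sum_abs _ _).trans (Finset.sum_le_sum fun i hi => ?_)
  rw [abs_mul, abs_of_nonneg (hf i hi), mul_comm]
  exact mul_le_mul_of_nonneg_right (hw i hi) (hf i hi)

/-- With numerators `a, a'` and denominators `b, b'`, the difference is `(a - a' + (a'/b')(b' - b))
/ b`. Both terms of the numerator are at most `N * M * d`, because `|a'/b'| ≤ M`. -/
theorem abs_weightedMean_sub_le {ε d N : ℝ} (hε : 0 < ε) (hd : 0 ≤ d) (hM : 0 ≤ M)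
    (hS : (S.card : ℝ) ≤ N) (hg : ∀ i ∈ S, 0 ≤ g i)
    (hfε : ε ≤ ∑ i ∈ S, f i) (hgε : ε ≤ ∑ i ∈ S, g i) (hfg : ∀ i ∈ S, |f i - g i| ≤ d)
    (hw : ∀ i ∈ S, |w i| ≤ M) :
    |(∑ i ∈ S, f i * w i) / ∑ i ∈ S, f i - (∑ i ∈ S, g i * w i) / ∑ i ∈ S, g i| ≤
      2 * N * M * d / ε := by
  have hf0 : 0 < ∑ i ∈ S, f i := hε.trans_le hfε
  have hg0 : 0 < ∑ i ∈ S, g i := hε.trans_le hgε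
  have h1 : |∑ i ∈ S, f i * w i - ∑ i ∈ S, g i * w i| ≤ N * M * d := by
    rw [← Finset.sum_sub_distrib]
    calc |∑ i ∈ S, (f i * w i - g i * w i)| ≤ ∑ i ∈ S, |f i * w i - g i * w i| :=
          Finset.abs_sum_le_sum_abs _ _
      _ ≤ ∑ i ∈ S, d * M := by
          refine Finset.sum_le_sum fun i hi => ?_
          rw [← sub_mul, abs_mul]
          exact mul_le_mul (hfg i hi) (hw i hi) (abs_nonneg _) hd
      _ = S.card * (d * M) := by simp
      _ ≤ N * (d * M) := by gcongr
      _ = _ := by ring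
  have h2 : |∑ i ∈ S, g i - ∑ i ∈ S, f i| ≤ N * d := by
    rw [← Finset.sum_sub_distrib]
    calc |∑ i ∈ S, (g i - f i)| ≤ ∑ i ∈ S, |g i - f i| := Finset.abs_sum_le_sum_abs _ _
      _ ≤ ∑ i ∈ S, d := Finset.sum_le_sum fun i hi => by rw [abs_sub_comm]; exact hfg i hi
      _ = S.card * d := by simp
      _ ≤ N * d := by gcongr
  have h3 := abs_sum_mul_div_sum_le hg hg0 hw
  set a := ∑ i ∈ S, f i * w i
  set a' := ∑ i ∈ S, g i * w i
  set b := ∑ i ∈ S, f i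
  set b' := ∑ i ∈ S, g i
  have hsplit : a / b - a' / b' = (a - a' + a' / b' * (b' - b)) / b := by
    field_simp
    ring
  have hnum : |a - a' + a' / b' * (b' - b)| ≤ 2 * N * M * d := by
    refine (abs_add_le _ _).trans ?_
    rw [abs_mul]
    have := mul_le_mul h3 h2 (abs_nonneg _) hM
    linarith
  rw [hsplit, abs_div, abs_of_pos hf0]
  exact div_le_div₀ ((abs_nonneg _).trans hnum) hnum hε hfε

end WeightedMean

/-! ### Lipschitz extension of functions from the vertices to `X`. -/

section Extension

variable {X : Type*} [MetricSpace X] {A : Set X}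

/-- A Lipschitz bump function that is supported in the ball of radius `2ε` around a vertex. -/
noncomputable def bump (ε : ℝ) (v : Vertex A) (x : X) : ℝ := max 0 (2 * ε - dist x v.pt)

/-- The extension of a function on vertices to `X` by means of a Lipschitz partition of unity. -/
noncomputable def extension (ε : ℝ) (u : Vertex A → ℝ) (x : X) : ℝ :=
  (∑' v, bump ε v x * u v) / ∑' v : Vertex A, bump ε v x

theorem bump_nonneg (ε : ℝ) (v : Vertex A) (x : X) : 0 ≤ bump ε v x := le_max_left _ _

theorem abs_bump_sub_le (ε : ℝ) (v : Vertex A) (x y : X) :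
    |bump ε v x - bump ε v y| ≤ dist x y := by
  refine (abs_max_sub_max_le_max 0 (2 * ε - dist x v.pt) 0 (2 * ε - dist y v.pt)).trans ?_
  rw [sub_self, abs_zero, sub_sub_sub_cancel_left, max_eq_right (abs_nonneg _), abs_sub_comm]
  exact abs_dist_sub_le x y v.pt

variable [MeasurableSpace X] [OpensMeasurableSpace X] {μ : Measure X} {D : ℝ≥0} {ε : ℝ}

/-- Bumps that do not vanish somewhere on `B(v, ε)` belong to vertices within `3ε` of `v`, that is,
to `v` or its neighbours. Since the normalized weights add up to `1`, the value `u v` can be split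
off, leaving only edge differences. -/
theorem extension_eq (hμ : IsDoublingWith Metric.ball μ D) (hε : 0 < ε)
    (hA : IsMaximalSeparated ε A) (u : Vertex A → ℝ) (v : Vertex A) :
    ∃ S : Finset (Vertex A), (S.card : ℝ) ≤ D ^ 4 ∧ (∀ w ∈ S, w = v ∨ (graph ε A).Adj v w) ∧
      ∀ x ∈ Metric.ball v.pt ε, ε ≤ ∑ w ∈ S, bump ε w x ∧
        extension ε u x = (∑ w ∈ S, bump ε w x * (u w - u v)) / ∑ w ∈ S, bump ε w x + u v := by
  have hfin := finite_setOf_dist_lt hμ hε hA v.pt (3 * ε)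
  have hmem : ∀ w, w ∈ hfin.toFinset ↔ dist w.pt v.pt < 3 * ε := fun w => by simp
  refine ⟨hfin.toFinset, ?_, fun w hw => ?_, fun x hx => ?_⟩
  -- Here `4 * 3ε + ε = 13ε ≤ 2^4 ε`.
  · have h := card_le_of_separated hμ hε hA (x := v.pt) (R := 3 * ε) 4 (by linarith)
      hfin.toFinset fun w hw => (hmem w).1 hw
    exact_mod_cast h
  · by_cases hwv : w = v
    · exact Or.inl hwv
    · refine Or.inr ⟨Ne.symm hwv, ?_, ?_⟩
      · exact hA.separated _ v.2 _ w.2 fun h => hwv (Subtype.ext h.symm)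
      · rw [dist_comm]
        exact ((hmem w).1 hw).le
  · rw [Metric.mem_ball] at hx
    have hzero : ∀ w ∉ hfin.toFinset, bump ε w x = 0 := fun w hw => by
      rw [hmem, not_lt] at hw
      refine max_eq_left ?_
      linarith [dist_triangle w.pt x v.pt, dist_comm w.pt x]
    have hge : ε ≤ ∑ w ∈ hfin.toFinset, bump ε w x := by
      calc ε ≤ bump ε v x := (by linarith : ε ≤ 2 * ε - dist x v.pt).trans (le_max_right _ _)
        _ ≤ _ := Finset.single_le_sum (fun w _ => bump_nonneg ε w x)
            ((hmem v).2 (by rw [dist_self]; linarith))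
    refine ⟨hge, ?_⟩
    have hne : ∑ w ∈ hfin.toFinset, bump ε w x ≠ 0 := (hε.trans_le hge).ne'
    rw [extension, tsum_eq_sum (s := hfin.toFinset) (f := fun w => bump ε w x) hzero,
      tsum_eq_sum (s := hfin.toFinset) fun w hw => by rw [hzero w hw, zero_mul]]
    simp only [mul_sub, Finset.sum_sub_distrib, ← Finset.sum_mul]
    field_simp
    ring

theorem abs_extension_sub_le (hμ : IsDoublingWith Metric.ball μ D) (hε : 0 < ε)
    (hA : IsMaximalSeparated ε A) {u : Vertex A → ℝ} {v : Vertex A} {M : ℝ} (hM : 0 ≤ M)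
    (hu : ∀ w, (graph ε A).Adj v w → |u v - u w| ≤ M) {x : X} (hx : x ∈ Metric.ball v.pt ε) :
    |extension ε u x - u v| ≤ M := by
  obtain ⟨S, -, hadj, hS⟩ := extension_eq hμ hε hA u v
  obtain ⟨hge, heq⟩ := hS x hx
  rw [heq, add_sub_cancel_right]
  refine abs_sum_mul_div_sum_le (fun w _ => bump_nonneg ε w x) (hε.trans_le hge) fun w hw => ?_
  rcases hadj w hw with rfl | h
  · simpa using hM
  · rw [abs_sub_comm]
    exact hu w h

theorem abs_extension_sub_extension_le (hμ : IsDoublingWith Metric.ball μ D) (hε : 0 < ε)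
    (hA : IsMaximalSeparated ε A) {u : Vertex A → ℝ} {v : Vertex A} {M : ℝ} (hM : 0 ≤ M)
    (hu : ∀ w, (graph ε A).Adj v w → |u v - u w| ≤ M) {x y : X} (hx : x ∈ Metric.ball v.pt ε)
    (hy : y ∈ Metric.ball v.pt ε) :
    |extension ε u x - extension ε u y| ≤ 2 * D ^ 4 * M * dist x y / ε := by
  obtain ⟨S, hcard, hadj, hS⟩ := extension_eq hμ hε hA u v
  obtain ⟨hgex, heqx⟩ := hS x hx
  obtain ⟨hgey, heqy⟩ := hS y hy
  rw [heqx, heqy, add_sub_add_right_eq_sub]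
  refine abs_weightedMean_sub_le hε dist_nonneg hM hcard (fun w _ => bump_nonneg ε w y) hgex hgey
    (fun w _ => abs_bump_sub_le ε w x y) fun w hw => ?_
  rcases hadj w hw with rfl | h
  · simpa using hM
  · rw [abs_sub_comm]
    exact hu w h

theorem finite_neighborSet (hμ : IsDoublingWith Metric.ball μ D) (hε : 0 < ε)
    (hA : IsMaximalSeparated ε A) (v : Vertex A) : ((graph ε A).neighborSet v).Finite := by
  -- Neighbours may lie at distance exactly `3ε`, so a larger open ball is taken.
  refine (finite_setOf_dist_lt hμ hε hA v.pt (4 * ε)).subset fun w hw => ?_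
  have h : dist v.pt w.pt ≤ 3 * ε := hw.2.2
  rw [dist_comm] at h
  exact h.trans_lt (by linarith)

theorem exists_abs_sub_le (hμ : IsDoublingWith Metric.ball μ D) (hε : 0 < ε)
    (hA : IsMaximalSeparated ε A) (u : Vertex A → ℝ) (v : Vertex A) :
    ∃ M, 0 ≤ M ∧ ∀ w, (graph ε A).Adj v w → |u v - u w| ≤ M := by
  obtain ⟨M, hM⟩ := ((finite_neighborSet hμ hε hA v).image fun w => |u v - u w|).bddAbove
  exact ⟨max 0 M, le_max_left _ _, fun w hw =>
    (hM (mem_image_of_mem _ hw)).trans (le_max_right _ _)⟩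

theorem continuous_extension (hμ : IsDoublingWith Metric.ball μ D) (hε : 0 < ε)
    (hA : IsMaximalSeparated ε A) (u : Vertex A → ℝ) : Continuous (extension ε u) := by
  refine continuous_iff_continuousAt.2 fun x => ?_
  obtain ⟨v, hv⟩ := exists_dist_lt hε hA x
  obtain ⟨M, hM, hu⟩ := exists_abs_sub_le hμ hε hA u v
  have hlip : LipschitzOnWith (Real.toNNReal (2 * D ^ 4 * M / ε)) (extension ε u)
      (Metric.ball v.pt ε) := by
    refine LipschitzOnWith.of_dist_le_mul fun y hy z hz => ?_
    rw [Real.dist_eq, Real.coe_toNNReal _ (by positivity)]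
    exact (abs_extension_sub_extension_le hμ hε hA hM hu hy hz).trans_eq (by ring)
  exact hlip.continuousOn.continuousAt (Metric.isOpen_ball.mem_nhds hv)

theorem integrableOn_extension (hμ : IsDoublingWith Metric.ball μ D) (hε : 0 < ε)
    (hA : IsMaximalSeparated ε A) (u : Vertex A → ℝ) (x : X) (r : ℝ) :
    IntegrableOn (extension ε u) (Metric.ball x r) μ := by
  rcases le_or_gt r 0 with hr | hr
  · simp [Metric.ball_eq_empty.2 hr]
  choose M hM hu using exists_abs_sub_le hμ hε hA u
  obtain ⟨K, hK⟩ :=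
    ((finite_setOf_dist_lt hμ hε hA x (r + ε)).image fun v => |u v| + M v).bddAbove
  refine Measure.integrableOn_of_bounded (M := K) (hμ.finite x r hr).ne
    (continuous_extension hμ hε hA u).measurable.aestronglyMeasurable ?_
  refine (ae_restrict_iff' Metric.isOpen_ball.measurableSet).2 (ae_of_all _ fun y hy => ?_)
  obtain ⟨v, hv⟩ := exists_dist_lt hε hA y
  have h1 := abs_extension_sub_le hμ hε hA (hM v) (hu v) (x := y) hv
  have h2 : |u v| + M v ≤ K := by
    refine hK (mem_image_of_mem _ ?_)
    rw [Metric.mem_ball] at hy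
    rw [mem_ofPred_eq]
    linarith [dist_triangle v.pt y x, dist_comm v.pt y]
  rw [Real.norm_eq_abs]
  have h3 := abs_add_le (extension ε u y - u v) (u v)
  rw [sub_add_cancel] at h3
  linarith

/-- Upper gradients of the extension are controlled by bounds on the differences along edges. -/
theorem isUpperGradient_extension (hμ : IsDoublingWith Metric.ball μ D) (hε : 0 < ε)
    (hA : IsMaximalSeparated ε A) {u : Vertex A → ℝ} {M : Vertex A → ℝ} (hM : ∀ v, 0 ≤ M v)
    (hu : ∀ v w, (graph ε A).Adj v w → |u v - u w| ≤ M v) {ρ : X → ℝ≥0∞} (hρ : Measurable ρ)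
    (hMρ : ∀ v, ∀ x ∈ Metric.ball v.pt ε, ENNReal.ofReal (2 * D ^ 4 * M v / ε) ≤ ρ x) :
    IsUpperGradient (extension ε u) ρ := by
  refine isUpperGradient_of_open_cover (U := fun v : Vertex A => Metric.ball v.pt ε)
    (fun _ => Metric.isOpen_ball) (fun x => exists_dist_lt hε hA x)
    (L := fun v => ENNReal.ofReal (2 * D ^ 4 * M v / ε)) (fun v x hx y hy => ?_) hρ hMρ
  have h := abs_extension_sub_extension_le hμ hε hA (hM v) (hu v) hx hy
  have hMv := hM v
  rw [edist_dist, ← ENNReal.ofReal_mul (by positivity), Real.enorm_eq_ofReal_abs]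
  exact ENNReal.ofReal_le_ofReal (h.trans_eq (by ring))

end Extension

/-! ### Elementary properties of the graph metric. -/

section GraphMetric

theorem exists_two_pow_mul {ε s : ℝ} (hε : 0 < ε) (hs : ε ≤ s) :
    ∃ k : ℕ, s ≤ 2 ^ k * ε ∧ 2 ^ k * ε ≤ 2 * s := by
  obtain ⟨k, hk, hk'⟩ := exists_nat_pow_near ((one_le_div₀ hε).2 hs) one_lt_two
  rw [le_div_iff₀ hε] at hk
  rw [div_lt_iff₀ hε] at hk'
  exact ⟨k + 1, hk'.le, by rw [pow_succ]; linarith⟩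

variable {X : Type*} [MetricSpace X] {ε : ℝ} {A : Set X}

theorem dist_le_three_mul_graphDist (hconn : (graph ε A).Connected) (v w : Vertex A) :
    dist v.pt w.pt ≤ 3 * graphDist ε A v w := by
  have key : ∀ {v w : Vertex A} (q : (graph ε A).Walk v w),
      dist v.pt w.pt ≤ 3 * (ε * q.length) := by
    intro v w q
    induction q with
    | nil => simp
    | @cons x y z h q ih =>
      rw [SimpleGraph.Walk.length_cons]
      push_cast
      linarith [dist_triangle x.pt y.pt z.pt, h.2.2]
  obtain ⟨q, hq⟩ := hconn.exists_walk_length_eq_dist v w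
  have h := key q
  rwa [hq] at h

theorem graphBall_subset (hconn : (graph ε A).Connected) (v : Vertex A) (r : ℝ) :
    graphBall ε A v r ⊆ {w | dist w.pt v.pt < 3 * r} := by
  intro w hw
  have h1 := dist_le_three_mul_graphDist hconn v w
  have h2 : graphDist ε A v w < r := hw
  rw [mem_ofPred_eq, dist_comm]
  linarith

theorem graphBall_eq_singleton (hconn : (graph ε A).Connected) (hε : 0 < ε) (v : Vertex A) {r : ℝ}
    (hr : 0 < r) (hrε : r ≤ ε) : graphBall ε A v r = {v} := by
  ext w
  rw [mem_singleton_iff]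
  constructor
  · intro hw
    have h : ε * ((graph ε A).dist v w : ℝ) < r := hw
    have h1 : ((graph ε A).dist v w : ℝ) < 1 := by nlinarith
    have h2 : (graph ε A).dist v w = 0 := by
      have : (graph ε A).dist v w < 1 := by exact_mod_cast h1
      omega
    exact ((hconn.dist_eq_zero_iff).1 h2).symm
  · rintro rfl
    change ε * ((graph ε A).dist w w : ℝ) < r
    simpa using hr

end GraphMetric

/-! ### Connectedness, comparison of metrics and doubling of the vertex measure. -/

section Comparison

variable {X : Type*} [MetricSpace X] [MeasurableSpace X] [BorelSpace X] {μ : Measure X}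
  {D C : ℝ≥0} {ε p lam : ℝ} {A : Set X}

theorem setLAverage_extension_le (hμ : IsDoublingWith Metric.ball μ D) (hp : 0 < p)
    (hlam : 0 < lam) (hP : PoincareWith μ p C lam) (hε : 0 < ε) (hA : IsMaximalSeparated ε A)
    {u : Vertex A → ℝ} {δ : ℝ} (hδ : 0 ≤ δ)
    (hu : ∀ v w, (graph ε A).Adj v w → |u v - u w| ≤ δ) (x : X) {R : ℝ} (hR : 0 < R) :
    ⨍⁻ y in Metric.ball x R, ‖extension ε u y - ⨍ z in Metric.ball x R, extension ε u z ∂μ‖ₑ ∂μ ≤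
      ENNReal.ofReal (C * R * (2 * D ^ 4 * δ / ε)) := by
  have hug : IsUpperGradient (extension ε u) fun _ => ENNReal.ofReal (2 * D ^ 4 * δ / ε) :=
    isUpperGradient_extension hμ hε hA (M := fun _ => δ) (fun _ => hδ) hu measurable_const
      fun _ _ _ => le_rfl
  have h := hP _ _ (continuous_extension hμ hε hA u).measurable
    (integrableOn_extension hμ hε hA u) hug x R hR
  have hpos := hμ.pos x (lam * R) (by positivity)
  have hfin := hμ.finite x (lam * R) (by positivity)
  rw [setLAverage_eq (μ := μ) (s := Metric.ball x (lam * R)), setLIntegral_const,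
    ENNReal.mul_div_cancel_right hpos.ne' hfin.ne,
    ← ENNReal.rpow_mul, mul_one_div_cancel hp.ne', ENNReal.rpow_one] at h
  refine h.trans_eq ?_
  rw [ENNReal.ofReal_mul (by positivity), ENNReal.ofReal_mul C.coe_nonneg,
    ENNReal.ofReal_coe_nnreal]

theorem abs_average_extension_sub_le (hμ : IsDoublingWith Metric.ball μ D) (hp : 0 < p)
    (hlam : 0 < lam) (hP : PoincareWith μ p C lam) (hε : 0 < ε) (hA : IsMaximalSeparated ε A)
    {u : Vertex A → ℝ} {δ : ℝ} (hδ : 0 ≤ δ)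
    (hu : ∀ v w, (graph ε A).Adj v w → |u v - u w| ≤ δ) {x y : X} {s R : ℝ} (hs : 0 < s)
    (hsR : s + dist y x ≤ R) (n : ℕ) (hRs : R + dist x y ≤ 2 ^ n * s) :
    |(⨍ z in Metric.ball y s, extension ε u z ∂μ) - ⨍ z in Metric.ball x R, extension ε u z ∂μ| ≤
      D ^ n * (C * R * (2 * D ^ 4 * δ / ε)) := by
  have hR : 0 < R := by linarith [dist_nonneg (x := y) (y := x)]
  have h := enorm_setAverage_sub_le (Metric.ball_subset_ball' hsR) (hμ.pos y s hs).ne'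
    (hμ.finite x R hR).ne (hμ.measure_ball_le hs n hRs) (integrableOn_extension hμ hε hA u y s)
    (⨍ z in Metric.ball x R, extension ε u z ∂μ)
  have hreal := h.trans
    (mul_le_mul_right (setLAverage_extension_le hμ hp hlam hP hε hA hδ hu x hR) _)
  rw [← ENNReal.coe_pow, ← ENNReal.ofReal_coe_nnreal, ← ENNReal.ofReal_mul (NNReal.coe_nonneg _),
    Real.enorm_eq_ofReal_abs, ENNReal.ofReal_le_ofReal_iff (by positivity)] at hreal
  simpa using hreal

/-- The constant in the comparison of the graph metric with the metric of `X`. -/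
noncomputable def comparisonConst (D C : ℝ≥0) : ℝ := 3 + 3 * (4 * D ^ 5 * C) + D * (4 * D ^ 5 * C)

theorem comparisonConst_pos (D C : ℝ≥0) : 0 < comparisonConst D C := by
  unfold comparisonConst
  positivity

/-- A chain of balls: averages of the extension over successive dyadic balls differ by at most a
constant times the radius times `δ/ε`. The increments form a geometric series dominated by the
largest scale. -/
theorem abs_sub_le_of_adj_le (hμ : IsDoublingWith Metric.ball μ D) (hp : 0 < p)
    (hlam : 0 < lam) (hP : PoincareWith μ p C lam) (hε : 0 < ε) (hA : IsMaximalSeparated ε A)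
    {u : Vertex A → ℝ} {δ : ℝ} (hδ : 0 ≤ δ)
    (hu : ∀ v w, (graph ε A).Adj v w → |u v - u w| ≤ δ) (v w : Vertex A) (k : ℕ)
    (hvw : dist v.pt w.pt < 2 ^ k * ε) : |u v - u w| ≤ comparisonConst D C * 2 ^ k * δ := by
  set c : ℝ := 4 * D ^ 5 * C with hc
  have hc0 : 0 ≤ c := by positivity
  set a : Vertex A → ℕ → ℝ :=
    fun v k => ⨍ z in Metric.ball v.pt (2 ^ k * ε), extension ε u z ∂μ with ha
  have hbase : ∀ v, |a v 0 - u v| ≤ δ := by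
    intro v
    have hpos := hμ.pos v.pt ε hε
    have hfin := hμ.finite v.pt ε hε
    have h := enorm_setAverage_sub_le Subset.rfl hpos.ne' hfin.ne (D := 1) (by simp)
      (integrableOn_extension hμ hε hA u v.pt ε) (u v)
    have h2 : ⨍⁻ x in Metric.ball v.pt ε, ‖extension ε u x - u v‖ₑ ∂μ ≤ ENNReal.ofReal δ := by
      rw [setLAverage_eq, ENNReal.div_le_iff hpos.ne' hfin.ne, ← setLIntegral_const]
      refine setLIntegral_mono' Metric.isOpen_ball.measurableSet fun x hx => ?_
      rw [Real.enorm_eq_ofReal_abs]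
      exact ENNReal.ofReal_le_ofReal (abs_extension_sub_le hμ hε hA hδ (hu v) hx)
    rw [one_mul] at h
    have h3 := h.trans h2
    rw [Real.enorm_eq_ofReal_abs, ENNReal.ofReal_le_ofReal_iff hδ] at h3
    simpa [ha] using h3
  have hstep : ∀ v k, |a v k - a v (k + 1)| ≤ c * 2 ^ k * δ := by
    intro v k
    have hk : 0 < 2 ^ k * ε := by positivity
    have h := abs_average_extension_sub_le hμ hp hlam hP hε hA hδ hu (x := v.pt) (y := v.pt)
      (s := 2 ^ k * ε) (R := 2 ^ (k + 1) * ε) hk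
      (by rw [dist_self, pow_succ]; linarith) 1 (by rw [dist_self, pow_succ]; linarith)
    refine h.trans_eq ?_
    rw [hc, pow_succ]
    field_simp
    ring
  have hmean : ∀ v k, |a v k - u v| ≤ (1 + c) * 2 ^ k * δ := by
    intro v k
    -- The exact partial sum `1 + 2 + ... + 2^(k-1) = 2^k - 1` makes the induction close.
    suffices h : |a v k - u v| ≤ (1 + c * (2 ^ k - 1)) * δ by
      refine h.trans (mul_le_mul_of_nonneg_right ?_ hδ)
      have := one_le_pow₀ (M₀ := ℝ) one_le_two (n := k)
      nlinarith
    induction k with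
    | zero => simpa using hbase v
    | succ k ih =>
      have h1 := abs_sub_le (a v (k + 1)) (a v k) (u v)
      have h2 := hstep v k
      rw [abs_sub_comm] at h2
      rw [pow_succ]
      linarith
  -- The ball of radius `2^k ε` at `w` lies in the ball of twice that radius at `v`, which in turn
  -- lies in the ball of radius `4 * 2^k ε` at `w`; hence two doublings.
  have hcross : |a w k - a v (k + 1)| ≤ D * c * 2 ^ k * δ := by
    have hk : 0 < 2 ^ k * ε := by positivity
    have h := abs_average_extension_sub_le hμ hp hlam hP hε hA hδ hu (x := v.pt) (y := w.pt)
      (s := 2 ^ k * ε) (R := 2 ^ (k + 1) * ε) hk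
      (by rw [dist_comm, pow_succ]; linarith) 2 (by rw [pow_succ]; linarith)
    refine h.trans_eq ?_
    rw [hc, pow_succ]
    field_simp
    ring
  have h1 := hmean v (k + 1)
  have h2 := hmean w k
  rw [abs_sub_comm] at h1 hcross
  have h3 := abs_sub_le (u v) (a v (k + 1)) (u w)
  have h4 := abs_sub_le (a v (k + 1)) (a w k) (u w)
  rw [pow_succ] at h1
  rw [comparisonConst, ← hc]
  linarith

theorem graph_connected (hμ : IsDoublingWith Metric.ball μ D) (hp : 0 < p)
    (hlam : 0 < lam) (hP : PoincareWith μ p C lam) (hε : 0 < ε) (hA : IsMaximalSeparated ε A) :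
    (graph ε A).Connected := by
  classical
  have hX : Nonempty X := by
    by_contra h
    rw [not_nonempty_iff] at h
    exact hμ.ne_zero (Measure.eq_zero_of_isEmpty μ)
  have : Nonempty (Vertex A) := ⟨(exists_dist_lt hε hA hX.some).choose⟩
  refine ⟨fun v w => ?_⟩
  -- The indicator of the component of `v` does not change along edges, so the estimate with `δ = 0`
  -- makes it constant.
  set u : Vertex A → ℝ := fun w => if (graph ε A).Reachable v w then 1 else 0 with hu
  have hadj : ∀ x y, (graph ε A).Adj x y → |u x - u y| ≤ 0 := by
    intro x y hxy
    have h : (graph ε A).Reachable v x ↔ (graph ε A).Reachable v y :=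
      ⟨fun h => h.trans hxy.reachable, fun h => h.trans hxy.symm.reachable⟩
    simp [hu, h]
  obtain ⟨k, hk⟩ := pow_unbounded_of_one_lt (dist v.pt w.pt / ε) (one_lt_two (α := ℝ))
  rw [div_lt_iff₀ hε] at hk
  have h := abs_sub_le_of_adj_le hμ hp hlam hP hε hA le_rfl hadj v w k hk
  by_contra hvw
  have hv : (graph ε A).Reachable v v := SimpleGraph.Reachable.refl v
  simp only [hu, hvw, hv, if_true, if_false] at h
  norm_num at h

/-- The combinatorial distance from `v` changes by at most `1` along an edge, so the chaining
estimate applies to it with `δ = 1`; rounding `s` up to some `2^k ε` costs a factor of `2`. -/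
theorem graphDist_le (hμ : IsDoublingWith Metric.ball μ D) (hp : 0 < p)
    (hlam : 0 < lam) (hP : PoincareWith μ p C lam) (hε : 0 < ε) (hA : IsMaximalSeparated ε A)
    {v w : Vertex A} {s : ℝ} (hs : ε ≤ s) (hvw : dist v.pt w.pt < s) :
    graphDist ε A v w ≤ 2 * comparisonConst D C * s := by
  have hconn := graph_connected hμ hp hlam hP hε hA
  obtain ⟨k, hk, hk'⟩ := exists_two_pow_mul hε hs
  have hadj : ∀ x y, (graph ε A).Adj x y →
      |((graph ε A).dist v x : ℝ) - (graph ε A).dist v y| ≤ 1 := by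
    intro x y hxy
    have h1 := hconn.dist_triangle (u := v) (v := x) (w := y)
    have h2 := hconn.dist_triangle (u := v) (v := y) (w := x)
    rw [SimpleGraph.dist_eq_one_iff_adj.2 hxy] at h1
    rw [SimpleGraph.dist_eq_one_iff_adj.2 hxy.symm] at h2
    rw [abs_le]
    constructor
    · have : ((graph ε A).dist v y : ℝ) ≤ (graph ε A).dist v x + 1 := by exact_mod_cast h1
      linarith
    · have : ((graph ε A).dist v x : ℝ) ≤ (graph ε A).dist v y + 1 := by exact_mod_cast h2
      linarith
  have h := abs_sub_le_of_adj_le hμ hp hlam hP hε hA zero_le_one hadj v w k (hvw.trans_le hk)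
  rw [SimpleGraph.dist_self, Nat.cast_zero, zero_sub, abs_neg, Nat.abs_cast, mul_one] at h
  have hK := comparisonConst_pos D C
  calc graphDist ε A v w ≤ ε * (comparisonConst D C * 2 ^ k) := by
        unfold graphDist
        gcongr
    _ = comparisonConst D C * (2 ^ k * ε) := by ring
    _ ≤ comparisonConst D C * (2 * s) := by gcongr
    _ = _ := by ring

/-- The factor by which balls of `X` have to be enlarged to contain balls of the graph. -/
noncomputable def enlargement (D C : ℝ≥0) : ℝ := 2 * comparisonConst D C + 1

theorem one_le_enlargement (D C : ℝ≥0) : 1 ≤ enlargement D C := by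
  linarith [comparisonConst_pos D C, enlargement.eq_def D C]

theorem subset_graphBall (hμ : IsDoublingWith Metric.ball μ D) (hp : 0 < p)
    (hlam : 0 < lam) (hP : PoincareWith μ p C lam) (hε : 0 < ε) (hA : IsMaximalSeparated ε A)
    (v : Vertex A) {s : ℝ} (hs : ε ≤ s) :
    {w | dist w.pt v.pt < s} ⊆ graphBall ε A v (enlargement D C * s) := by
  intro w hw
  rw [mem_ofPred_eq, dist_comm] at hw
  have h := graphDist_le hμ hp hlam hP hε hA hs hw
  change graphDist ε A v w < _
  rw [enlargement]
  linarith

theorem finite_graphBall (hμ : IsDoublingWith Metric.ball μ D) (hε : 0 < ε)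
    (hA : IsMaximalSeparated ε A) (hconn : (graph ε A).Connected) (v : Vertex A) (r : ℝ) :
    (graphBall ε A v r).Finite :=
  (finite_setOf_dist_lt hμ hε hA v.pt (3 * r)).subset (graphBall_subset hconn v r)

theorem vertexMeasure_graphBall_le (hμ : IsDoublingWith Metric.ball μ D) (hε : 0 < ε)
    (hA : IsMaximalSeparated ε A) (hconn : (graph ε A).Connected) (v : Vertex A) {r : ℝ}
    (hr : ε ≤ r) :
    vertexMeasure μ ε A (graphBall ε A v r) ≤ D ^ 4 * μ (Metric.ball v.pt (4 * r)) :=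
  calc vertexMeasure μ ε A (graphBall ε A v r)
      ≤ vertexMeasure μ ε A {w | dist w.pt v.pt < 3 * r} :=
        measure_mono (graphBall_subset hconn v r)
    _ ≤ D ^ 4 * μ (Metric.ball v.pt (3 * r + ε)) := vertexMeasure_le hμ hε hA v.pt (3 * r)
    _ ≤ D ^ 4 * μ (Metric.ball v.pt (4 * r)) := by
        gcongr
        linarith

theorem measure_ball_le_vertexMeasure_graphBall (hμ : IsDoublingWith Metric.ball μ D) (hp : 0 < p)
    (hlam : 0 < lam) (hP : PoincareWith μ p C lam) (hε : 0 < ε) (hA : IsMaximalSeparated ε A)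
    (v : Vertex A) {s : ℝ} (hs : 0 < s) :
    μ (Metric.ball v.pt s) ≤ vertexMeasure μ ε A (graphBall ε A v (2 * enlargement D C * s)) := by
  have hE := one_le_enlargement D C
  rcases le_total s ε with h | h
  · calc μ (Metric.ball v.pt s) ≤ μ (Metric.ball v.pt ε) := by gcongr
      _ = vertexMeasure μ ε A {v} := (vertexMeasure_singleton v).symm
      _ ≤ _ := by
        refine measure_mono (singleton_subset_iff.2 ?_)
        change ε * ((graph ε A).dist v v : ℝ) < _
        rw [SimpleGraph.dist_self, Nat.cast_zero, mul_zero]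
        positivity
  · refine (measure_ball_le_vertexMeasure hμ hε hA v.pt s).trans (measure_mono ?_)
    refine Subset.trans ?_ (subset_graphBall hμ hp hlam hP hε hA v (h.trans (by linarith :
      s ≤ 2 * s))) |>.trans_eq (by rw [← mul_assoc, mul_comm _ 2])
    intro w hw
    rw [mem_ofPred_eq] at hw ⊢
    linarith

/-- The graph ball of radius `R` is compared with a metric ball of radius `4R`, and that of radius
`r` with one of radius `r / (2E)`, where `E` is the enlargement factor. The ratio of the radii is
`8ER/r`. -/
theorem vertexMeasure_graphBall_le_graphBall (hμ : IsDoublingWith Metric.ball μ D) (hp : 0 < p)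
    (hlam : 0 < lam) (hP : PoincareWith μ p C lam) (hε : 0 < ε) (hA : IsMaximalSeparated ε A)
    (v : Vertex A) {r R : ℝ} (hr : 0 < r) (hR : ε ≤ R) (n : ℕ)
    (hn : 8 * enlargement D C * R ≤ 2 ^ n * r) :
    vertexMeasure μ ε A (graphBall ε A v R) ≤
      D ^ (n + 4) * vertexMeasure μ ε A (graphBall ε A v r) := by
  have hconn := graph_connected hμ hp hlam hP hε hA
  have hE := one_le_enlargement D C
  have hE0 : 0 < 2 * enlargement D C := by linarith
  calc vertexMeasure μ ε A (graphBall ε A v R)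
      ≤ D ^ 4 * μ (Metric.ball v.pt (4 * R)) := vertexMeasure_graphBall_le hμ hε hA hconn v hR
    _ ≤ D ^ 4 * (D ^ n * μ (Metric.ball v.pt (r / (2 * enlargement D C)))) := by
        gcongr
        refine hμ.measure_ball_le (by positivity) n ?_
        rw [dist_self, add_zero, ← mul_div_assoc, le_div_iff₀ hE0]
        linarith
    _ ≤ D ^ 4 * (D ^ n * vertexMeasure μ ε A (graphBall ε A v r)) := by
        gcongr
        have h := measure_ball_le_vertexMeasure_graphBall hμ hp hlam hP hε hA v
          (s := r / (2 * enlargement D C)) (by positivity)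
        rwa [mul_div_cancel₀ _ hE0.ne'] at h
    _ = _ := by ring

theorem isDoublingWith_vertexMeasure (hμ : IsDoublingWith Metric.ball μ D) (hp : 0 < p)
    (hlam : 0 < lam) (hP : PoincareWith μ p C lam) (hε : 0 < ε) (hA : IsMaximalSeparated ε A)
    (n : ℕ) (hn : 16 * enlargement D C ≤ 2 ^ n) :
    IsDoublingWith (graphBall ε A) (vertexMeasure μ ε A) (D ^ (n + 4)) := by
  have hconn := graph_connected hμ hp hlam hP hε hA
  have hpos : ∀ v r, 0 < r → 0 < vertexMeasure μ ε A (graphBall ε A v r) := by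
    intro v r hr
    refine (hμ.pos v.pt ε hε).trans_le ?_
    rw [← vertexMeasure_singleton]
    refine measure_mono (singleton_subset_iff.2 ?_)
    change ε * ((graph ε A).dist v v : ℝ) < _
    simpa using hr
  refine ⟨one_le_pow₀ hμ.one_le, ?_, hpos, ?_, ?_⟩
  · intro h
    obtain ⟨v⟩ := hconn.nonempty
    have := hpos v 1 one_pos
    simp [h] at this
  · intro v r _
    have hfin := finite_graphBall hμ hε hA hconn v r
    rw [← hfin.coe_toFinset, vertexMeasure_finset]
    exact ENNReal.sum_lt_top.2 fun w _ => hμ.finite w.pt ε hε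
  · intro v r hr
    -- Below the scale `ε` both balls are the same single vertex.
    rcases le_total (2 * r) ε with h | h
    · rw [graphBall_eq_singleton hconn hε v (by positivity) h,
        graphBall_eq_singleton hconn hε v hr (by linarith)]
      have h1 : (1 : ℝ≥0∞) ≤ ((D ^ (n + 4) : ℝ≥0) : ℝ≥0∞) := by
        exact_mod_cast one_le_pow₀ hμ.one_le
      calc vertexMeasure μ ε A {v} = 1 * vertexMeasure μ ε A {v} := (one_mul _).symm
        _ ≤ _ := by gcongr
    · rw [ENNReal.coe_pow]
      refine vertexMeasure_graphBall_le_graphBall hμ hp hlam hP hε hA v hr h n ?_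
      nlinarith

end Comparison

/-! ### The discrete Poincaré inequality. -/

section DiscretePoincare

theorem div_rpow_le_mul_div_rpow {I m m' K : ℝ≥0∞} (hm : m ≠ 0) (hm_top : m ≠ ∞) (hm' : m' ≠ 0)
    (hm'_top : m' ≠ ∞) (hK : 1 ≤ K) (h : m' ≤ K * m) {p : ℝ} (hp : 1 ≤ p) :
    (I / m) ^ (1 / p) ≤ K * (I / m') ^ (1 / p) := by
  have hp0 : 0 < p := by linarith
  have h1 : I / m ≤ K * (I / m') := by
    rw [ENNReal.div_le_iff hm hm_top]
    calc I = I / m' * m' := (ENNReal.div_mul_cancel hm' hm'_top).symm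
      _ ≤ I / m' * (K * m) := by gcongr
      _ = _ := by ring
  calc (I / m) ^ (1 / p) ≤ (K * (I / m')) ^ (1 / p) := by gcongr
    _ = K ^ (1 / p) * (I / m') ^ (1 / p) := ENNReal.mul_rpow_of_nonneg _ _ (by positivity)
    _ ≤ K ^ (1 : ℝ) * (I / m') ^ (1 / p) := by
        gcongr
        exact (div_le_one hp0).2 hp
    _ = _ := by rw [ENNReal.rpow_one]

variable {X : Type*} [MetricSpace X] {A : Set X}

/-- The sum of `|u v - u w| ^ p / ε ^ p` over the neighbours `w` of `v`. -/
noncomputable def edgeEnergy (ε p : ℝ) (u : Vertex A → ℝ) (v : Vertex A) : ℝ≥0∞ :=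
  ∑' w : (graph ε A).neighborSet v, ‖u v - u w‖ₑ ^ p / ENNReal.ofReal ε ^ p

variable {ε p : ℝ}

theorem enorm_sub_le_edgeEnergy (hε : 0 < ε) (hp : 0 < p) (u : Vertex A → ℝ) {v w : Vertex A}
    (h : (graph ε A).Adj v w) :
    ‖u v - u w‖ₑ ≤ ENNReal.ofReal ε * edgeEnergy ε p u v ^ (1 / p) := by
  have hε0 : ENNReal.ofReal ε ≠ 0 := by simpa using hε
  have h1 : ‖u v - u w‖ₑ ^ p / ENNReal.ofReal ε ^ p ≤ edgeEnergy ε p u v :=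
    ENNReal.le_tsum (f := fun w : (graph ε A).neighborSet v =>
      ‖u v - u w‖ₑ ^ p / ENNReal.ofReal ε ^ p) ⟨w, h⟩
  have h2 : ‖u v - u w‖ₑ / ENNReal.ofReal ε ≤ edgeEnergy ε p u v ^ (1 / p) := by
    rw [one_div, ENNReal.le_rpow_inv_iff hp, ENNReal.div_rpow_of_nonneg _ _ hp.le]
    exact h1
  rw [mul_comm]
  exact (ENNReal.div_le_iff hε0 ENNReal.ofReal_ne_top).1 h2

variable [MeasurableSpace X] [BorelSpace X] {μ : Measure X} {D C : ℝ≥0} {lam : ℝ}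

theorem edgeEnergy_ne_top (hμ : IsDoublingWith Metric.ball μ D) (hε : 0 < ε) (hp : 0 < p)
    (hA : IsMaximalSeparated ε A) (u : Vertex A → ℝ) (v : Vertex A) :
    edgeEnergy ε p u v ≠ ∞ := by
  have hε0 : ENNReal.ofReal ε ^ p ≠ 0 := by
    rw [Ne, ENNReal.rpow_eq_zero_iff_of_pos hp]
    simpa using hε
  have := (finite_neighborSet hμ hε hA v).fintype
  rw [edgeEnergy, tsum_fintype]
  exact ENNReal.sum_ne_top.2 fun w _ =>
    ENNReal.div_ne_top (ENNReal.rpow_ne_top_of_nonneg hp.le enorm_ne_top) hε0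

theorem enorm_extension_sub_le (hμ : IsDoublingWith Metric.ball μ D) (hε : 0 < ε) (hp : 0 < p)
    (hA : IsMaximalSeparated ε A) (u : Vertex A → ℝ) {v : Vertex A} {x : X}
    (hx : x ∈ Metric.ball v.pt ε) :
    ‖u v - extension ε u x‖ₑ ≤ ENNReal.ofReal ε * edgeEnergy ε p u v ^ (1 / p) := by
  have htop : ENNReal.ofReal ε * edgeEnergy ε p u v ^ (1 / p) ≠ ∞ :=
    ENNReal.mul_ne_top ENNReal.ofReal_ne_top
      (ENNReal.rpow_ne_top_of_nonneg (by positivity) (edgeEnergy_ne_top hμ hε hp hA u v))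
  have h := abs_extension_sub_le hμ hε hA (u := u) (v := v)
    (ENNReal.toReal_nonneg (a := ENNReal.ofReal ε * edgeEnergy ε p u v ^ (1 / p)))
    (fun w hw => ?_) hx
  · rw [Real.enorm_eq_ofReal_abs, abs_sub_comm]
    exact ENNReal.ofReal_le_of_le_toReal h
  · have h1 := enorm_sub_le_edgeEnergy hε hp u hw
    rw [Real.enorm_eq_ofReal_abs] at h1
    exact (ENNReal.ofReal_le_iff_le_toReal htop).1 h1

/-- The Poincaré inequality on `X` for the extension of `u`, in terms of the energy of `u`. -/
theorem setLAverage_extension_le_edgeEnergy (hμ : IsDoublingWith Metric.ball μ D) (hp : 0 < p)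
    (hP : PoincareWith μ p C lam) (hε : 0 < ε) (hA : IsMaximalSeparated ε A)
    (u : Vertex A → ℝ) (x : X) {R : ℝ} (hR : 0 < R) :
    ⨍⁻ y in Metric.ball x R, ‖extension ε u y - ⨍ z in Metric.ball x R, extension ε u z ∂μ‖ₑ ∂μ ≤
      C * ENNReal.ofReal R * (2 * D ^ 4 *
        ((∫⁻ v in {v | dist v.pt x < lam * R + ε}, edgeEnergy ε p u v ∂(vertexMeasure μ ε A)) /
          μ (Metric.ball x (lam * R))) ^ (1 / p)) := by
  have := countable_vertex hμ hε hA
  set M : Vertex A → ℝ≥0∞ := fun v => ENNReal.ofReal ε * edgeEnergy ε p u v ^ (1 / p) with hM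
  have hMtop : ∀ v, M v ≠ ∞ := fun v => ENNReal.mul_ne_top ENNReal.ofReal_ne_top
    (ENNReal.rpow_ne_top_of_nonneg (by positivity) (edgeEnergy_ne_top hμ hε hp hA u v))
  -- With this `g`, the `p`-th power of the upper gradient is linear in the vertex energies, so its
  -- integral is bounded by the discrete energy term by term.
  set g : X → ℝ≥0∞ := fun y =>
    ∑' v, (Metric.ball v.pt ε).indicator (fun _ => edgeEnergy ε p u v) y with hg
  have hgmeas : Measurable g := Measurable.tsum fun v =>
    measurable_const.indicator Metric.isOpen_ball.measurableSet
  have hug : IsUpperGradient (extension ε u) fun y => 2 * D ^ 4 * g y ^ (1 / p) := by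
    refine isUpperGradient_extension hμ hε hA (M := fun v => (M v).toReal)
      (fun v => ENNReal.toReal_nonneg) (fun v w hvw => ?_) ((hgmeas.pow_const _).const_mul _) ?_
    · have h1 := enorm_sub_le_edgeEnergy hε hp u hvw
      rw [Real.enorm_eq_ofReal_abs] at h1
      exact (ENNReal.ofReal_le_iff_le_toReal (hMtop v)).1 h1
    · intro v y hy
      have h1 : edgeEnergy ε p u v ≤ g y := by
        refine le_trans (le_of_eq ?_) (ENNReal.le_tsum v)
        rw [indicator_of_mem hy]
      have h2 : ENNReal.ofReal (2 * D ^ 4 * (M v).toReal / ε) =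
          2 * D ^ 4 * edgeEnergy ε p u v ^ (1 / p) := by
        have h3 : 2 * (D : ℝ) ^ 4 * (M v).toReal / ε =
            ((2 * D ^ 4 : ℝ≥0) : ℝ) * (edgeEnergy ε p u v ^ (1 / p)).toReal := by
          simp only [hM]
          rw [ENNReal.toReal_mul, ENNReal.toReal_ofReal hε.le]
          push_cast
          field_simp
        rw [h3, ENNReal.ofReal_mul (NNReal.coe_nonneg _), ENNReal.ofReal_coe_nnreal,
          ENNReal.ofReal_toReal (ENNReal.rpow_ne_top_of_nonneg (by positivity)
            (edgeEnergy_ne_top hμ hε hp hA u v))]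
        push_cast
        rfl
      rw [h2]
      gcongr
  have h := hP _ _ (continuous_extension hμ hε hA u).measurable
    (integrableOn_extension hμ hε hA u) hug x R hR
  refine h.trans ?_
  gcongr
  have hpow : ∀ y, (2 * D ^ 4 * g y ^ (1 / p)) ^ p = (2 * D ^ 4 : ℝ≥0∞) ^ p * g y := fun y => by
    rw [ENNReal.mul_rpow_of_nonneg _ _ hp.le, ← ENNReal.rpow_mul, one_div_mul_cancel hp.ne',
      ENNReal.rpow_one]
  simp only [hpow]
  rw [setLAverage_eq, lintegral_const_mul _ hgmeas, mul_div_assoc,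
    ENNReal.mul_rpow_of_nonneg _ _ (by positivity), ← ENNReal.rpow_mul,
    mul_one_div_cancel hp.ne', ENNReal.rpow_one]
  gcongr
  exact setLIntegral_tsum_indicator_ball_le hμ hε hA x (lam * R) _

/-- For `y` in `B(v, ε)`, split `u v - c` at the value of the extension at `y`, and average over the
ball. Bounded overlap turns the sum over the vertices into one integral over `s`. -/
theorem setLIntegral_sub_const_le (hμ : IsDoublingWith Metric.ball μ D) (hp : 0 < p)
    (hε : 0 < ε) (hA : IsMaximalSeparated ε A) (u : Vertex A → ℝ) (c : ℝ)
    {W : Set (Vertex A)} (hW : W.Finite) {s : Set X} (hs : MeasurableSet s)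
    (hWs : ∀ v ∈ W, Metric.ball v.pt ε ⊆ s) :
    ∫⁻ v in W, ‖u v - c‖ₑ ∂(vertexMeasure μ ε A) ≤
      ENNReal.ofReal ε * ∫⁻ v in W, edgeEnergy ε p u v ^ (1 / p) ∂(vertexMeasure μ ε A) +
        D ^ 4 * ∫⁻ y in s, ‖extension ε u y - c‖ₑ ∂μ := by
  lift W to Finset (Vertex A) using hW
  have hmeas : Measurable fun y => ‖extension ε u y - c‖ₑ :=
    ((continuous_extension hμ hε hA u).measurable.sub_const c).enorm
  refine le_trans ?_ (add_le_add_right (sum_setLIntegral_ball_le hμ hε hA hs W hWs hmeas) _)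
  rw [setLIntegral_vertexMeasure, setLIntegral_vertexMeasure, Finset.mul_sum,
    ← Finset.sum_add_distrib]
  refine Finset.sum_le_sum fun v _ => ?_
  calc μ (Metric.ball v.pt ε) * ‖u v - c‖ₑ = ∫⁻ _ in Metric.ball v.pt ε, ‖u v - c‖ₑ ∂μ := by
        rw [setLIntegral_const, mul_comm]
    _ ≤ ∫⁻ y in Metric.ball v.pt ε, (ENNReal.ofReal ε * edgeEnergy ε p u v ^ (1 / p) +
          ‖extension ε u y - c‖ₑ) ∂μ := by
        refine setLIntegral_mono' Metric.isOpen_ball.measurableSet fun y hy => ?_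
        rw [← sub_add_sub_cancel (u v) (extension ε u y) c]
        exact (enorm_add_le _ _).trans
          (add_le_add_left (enorm_extension_sub_le hμ hε hp hA u hy) _)
    _ = _ := by
        rw [lintegral_add_left measurable_const, setLIntegral_const]
        ring

theorem discretePoincareWith (hμ : IsDoublingWith Metric.ball μ D) (hp : 1 ≤ p)
    (hlam : 1 ≤ lam) (hP : PoincareWith μ p C lam) (hε : 0 < ε) (hA : IsMaximalSeparated ε A)
    (n : ℕ) (hn : 64 * enlargement D C ^ 2 * lam ≤ 2 ^ n) :
    DiscretePoincareWith μ ε A p (2 * (D ^ (n + 4) + 8 * C * D ^ 8 * (D ^ (n + 4)) ^ 2))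
      (8 * enlargement D C * lam) := by
  have hp0 : 0 < p := by linarith
  have hlam0 : 0 < lam := by linarith
  have hconn := graph_connected hμ hp0 hlam0 hP hε hA
  have hE := one_le_enlargement D C
  set E := enlargement D C with hEdef
  set m := vertexMeasure μ ε A with hm
  intro u v r hr
  have hBfin := finite_graphBall hμ hε hA hconn
  have hBpos : ∀ r, 0 < r → m (graphBall ε A v r) ≠ 0 := fun r hr => by
    have h : {v} ⊆ graphBall ε A v r := singleton_subset_iff.2 (by
      change ε * ((graph ε A).dist v v : ℝ) < r
      simpa using hr)
    refine ((hμ.pos v.pt ε hε).trans_le ?_).ne'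
    rw [← vertexMeasure_singleton]
    exact measure_mono h
  have hBtop : ∀ r, m (graphBall ε A v r) ≠ ∞ := fun r => by
    rw [← (hBfin v r).coe_toFinset, vertexMeasure_finset]
    exact ENNReal.sum_ne_top.2 fun w _ => (hμ.finite w.pt ε hε).ne
  have hint : IntegrableOn u (graphBall ε A v r) m :=
    integrableOn_vertexMeasure (hBfin v r) (hBtop r) u
  -- For `r ≤ ε` the ball is `{v}` and the left-hand side vanishes.
  rcases le_or_gt r ε with hrε | hrε
  · refine (setLAverage_sub_setAverage_le (hBpos r hr) (hBtop r) hint (u v)).trans ?_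
    have hzero : ∫⁻ w in graphBall ε A v r, ‖u w - u v‖ₑ ∂m = 0 := by
      rw [graphBall_eq_singleton hconn hε v hr hrε]
      simp
    rw [setLAverage_eq, hzero]
    simp
  change _ ≤ _ * _ * (⨍⁻ w in _, edgeEnergy ε p u w ∂m) ^ (1 / p)
  set B := graphBall ε A v r
  set B' := graphBall ε A v (8 * E * lam * r)
  set K : ℝ≥0∞ := D ^ (n + 4) with hK
  have hK1 : 1 ≤ K := by
    rw [hK]
    exact one_le_pow₀ (by exact_mod_cast hμ.one_le)
  have hElam : 1 ≤ E * lam := one_le_mul_of_one_le_of_one_le hE hlam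
  have hr' : r ≤ 8 * E * lam * r := by nlinarith
  have hBB' : B ⊆ B' := fun w hw => lt_of_lt_of_le (show graphDist ε A v w < r from hw) hr'
  have hB0 := hBpos r hr
  have hB'0 := hBpos (8 * E * lam * r) (by linarith)
  have hB't := hBtop (8 * E * lam * r)
  -- The factor `8E` of the ball comparison, applied to the radius `8 * E * lam * r`, is the origin
  -- of `64 * E ^ 2 * lam ≤ 2 ^ n`.
  have hmB : m B' ≤ K * m B := by
    refine vertexMeasure_graphBall_le_graphBall hμ hp0 hlam0 hP hε hA v hr (by linarith) n ?_
    calc 8 * E * (8 * E * lam * r) = 64 * E ^ 2 * lam * r := by ring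
      _ ≤ 2 ^ n * r := by gcongr
  -- Vertices of `B` lie within `3r` of `v` and `ε < r`, so their `ε`-balls lie in `B(v, 4r)`.
  set R := 4 * r with hR
  have hR0 : 0 < R := by positivity
  have hμR : μ (Metric.ball v.pt R) ≤ K * m B := by
    refine le_trans ?_ hmB
    refine (measure_ball_le_vertexMeasure_graphBall hμ hp0 hlam0 hP hε hA v hR0).trans ?_
    refine measure_mono fun w hw => lt_of_lt_of_le (show graphDist ε A v w < _ from hw) ?_
    rw [← hEdef, hR]
    nlinarith [mul_nonneg (mul_nonneg (by linarith : 0 ≤ E) hr.le) (sub_nonneg.2 hlam)]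
  have hmμ : m B' ≤ K * μ (Metric.ball v.pt (lam * R)) := by
    refine (vertexMeasure_graphBall_le hμ hε hA hconn v (by linarith)).trans ?_
    have h8 : 8 * E ≤ 2 ^ n := by
      refine le_trans ?_ hn
      nlinarith [mul_le_mul hE hElam zero_le_one (by linarith)]
    have hball : μ (Metric.ball v.pt (4 * (8 * E * lam * r))) ≤
        D ^ n * μ (Metric.ball v.pt (lam * R)) := by
      refine hμ.measure_ball_le (by positivity) n ?_
      rw [dist_self, add_zero, hR]
      calc 4 * (8 * E * lam * r) = 8 * E * (lam * (4 * r)) := by ring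
        _ ≤ _ := by gcongr
    calc D ^ 4 * μ (Metric.ball v.pt (4 * (8 * E * lam * r)))
        ≤ D ^ 4 * (D ^ n * μ (Metric.ball v.pt (lam * R))) := by gcongr
      _ = _ := by rw [hK]; ring
  set I := ∫⁻ w in B', edgeEnergy ε p u w ∂m with hI
  set T := (I / m B') ^ (1 / p) with hT
  set c := ⨍ z in Metric.ball v.pt R, extension ε u z ∂μ with hc
  have hT' : (⨍⁻ w in B', edgeEnergy ε p u w ∂m) ^ (1 / p) = T := by rw [setLAverage_eq]
  have hfirst : ⨍⁻ w in B, edgeEnergy ε p u w ^ (1 / p) ∂m ≤ K * T := by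
    refine (setLAverage_rpow_le hB0 (hBtop r) hp measurable_from_top).trans ?_
    refine le_trans ?_ (div_rpow_le_mul_div_rpow hB0 (hBtop r) hB'0 hB't hK1 hmB hp)
    rw [setLAverage_eq]
    gcongr
    exact lintegral_mono_set hBB'
  have hsecond : ⨍⁻ y in Metric.ball v.pt R, ‖extension ε u y - c‖ₑ ∂μ ≤
      C * ENNReal.ofReal R * (2 * D ^ 4 * (K * T)) := by
    refine (setLAverage_extension_le_edgeEnergy hμ hp0 hP hε hA u v.pt hR0).trans ?_
    gcongr
    refine le_trans ?_ (div_rpow_le_mul_div_rpow (hμ.pos v.pt (lam * R) (by positivity)).ne'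
      (hμ.finite v.pt (lam * R) (by positivity)).ne hB'0 hB't hK1 hmμ hp)
    gcongr
    refine lintegral_mono_set ?_
    -- Here `lam * R + ε ≤ 5 * lam * r`, and the graph ball of radius `5 * E * lam * r` is contained
    -- in `B'`.
    have hsub : {w : Vertex A | dist w.pt v.pt < lam * R + ε} ⊆
        {w | dist w.pt v.pt < 5 * lam * r} := fun w hw => by
      rw [mem_ofPred_eq] at hw ⊢
      rw [hR] at hw
      nlinarith
    refine hsub.trans ((subset_graphBall hμ hp0 hlam0 hP hε hA v (by nlinarith)).trans ?_)
    refine fun w hw => lt_of_lt_of_le (show graphDist ε A v w < _ from hw) ?_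
    rw [← hEdef]
    nlinarith [mul_pos (mul_pos (by linarith : 0 < E) hlam0) hr]
  have hmain := setLIntegral_sub_const_le hμ hp0 hε hA u c (hBfin v r)
    (s := Metric.ball v.pt R) Metric.isOpen_ball.measurableSet fun w hw => by
      have := graphBall_subset hconn v r hw
      rw [mem_ofPred_eq] at this
      exact Metric.ball_subset_ball' (by rw [hR]; linarith)
  have hsecond' : (∫⁻ y in Metric.ball v.pt R, ‖extension ε u y - c‖ₑ ∂μ) / m B ≤
      K * (C * ENNReal.ofReal R * (2 * D ^ 4 * (K * T))) := by
    have hμ0 := (hμ.pos v.pt R hR0).ne'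
    have hμt := (hμ.finite v.pt R hR0).ne
    rw [setLAverage_eq, ENNReal.div_le_iff hμ0 hμt] at hsecond
    rw [ENNReal.div_le_iff hB0 (hBtop r)]
    calc ∫⁻ y in Metric.ball v.pt R, ‖extension ε u y - c‖ₑ ∂μ
        ≤ C * ENNReal.ofReal R * (2 * D ^ 4 * (K * T)) * μ (Metric.ball v.pt R) := hsecond
      _ ≤ C * ENNReal.ofReal R * (2 * D ^ 4 * (K * T)) * (K * m B) := by gcongr
      _ = _ := by ring
  rw [hT']
  calc ⨍⁻ w in B, ‖u w - ⨍ z in B, u z ∂m‖ₑ ∂m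
      ≤ 2 * ⨍⁻ w in B, ‖u w - c‖ₑ ∂m := setLAverage_sub_setAverage_le hB0 (hBtop r) hint c
    _ ≤ 2 * ((ENNReal.ofReal ε * ∫⁻ w in B, edgeEnergy ε p u w ^ (1 / p) ∂m +
          D ^ 4 * ∫⁻ y in Metric.ball v.pt R, ‖extension ε u y - c‖ₑ ∂μ) / m B) := by
        rw [setLAverage_eq]
        gcongr
    _ = 2 * (ENNReal.ofReal ε * ⨍⁻ w in B, edgeEnergy ε p u w ^ (1 / p) ∂m +
          D ^ 4 * ((∫⁻ y in Metric.ball v.pt R, ‖extension ε u y - c‖ₑ ∂μ) / m B)) := by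
        rw [setLAverage_eq, ENNReal.add_div, mul_div_assoc, mul_div_assoc]
    _ ≤ 2 * (ENNReal.ofReal r * (K * T) +
          D ^ 4 * (K * (C * ENNReal.ofReal R * (2 * D ^ 4 * (K * T))))) := by
        gcongr
    _ = _ := by
        rw [hR, ENNReal.ofReal_mul (by norm_num), ENNReal.ofReal_ofNat, hK]
        push_cast
        ring

end DiscretePoincare

end Discretization

/-! ### Choice of the constants and conclusion. -/

theorem theorem1p1 (p : ℝ) (hp : 1 ≤ p) (Cμ : ℝ≥0) (hCμ : 1 ≤ Cμ) (C : ℝ≥0) (hC : 0 < C)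
    (lam : ℝ) (hlam : 1 ≤ lam) :
    ∃ (Cm C' : ℝ≥0) (lam' : ℝ), 1 ≤ Cm ∧ 0 < C' ∧ 1 ≤ lam' ∧
      ∀ (X : Type*) [MetricSpace X] [CompleteSpace X] [MeasurableSpace X] [BorelSpace X]
        (μ : Measure X),
        Discretization.IsDoublingWith Metric.ball μ Cμ →
        Discretization.PoincareWith μ p C lam →
        ∀ (ε : ℝ) (A : Set X), 0 < ε → Discretization.IsMaximalSeparated ε A →
          (Discretization.graph ε A).Connected ∧
          (∀ v r, (Discretization.graphBall ε A v r).Finite) ∧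
          Discretization.IsDoublingWith (Discretization.graphBall ε A)
            (Discretization.vertexMeasure μ ε A) Cm ∧
          Discretization.DiscretePoincareWith μ ε A p C' lam' := by
  have hp0 : 0 < p := by linarith
  have hlam0 : 0 < lam := by linarith
  have hE := Discretization.one_le_enlargement Cμ C
  set E := Discretization.enlargement Cμ C
  have hElam : 1 ≤ E * lam := one_le_mul_of_one_le_of_one_le hE hlam
  -- This `n` depends only on the data and serves both conclusions: doubling needs only `16 * E ≤ 2
  -- ^ n`, which follows from `E * lam ≥ 1`.
  obtain ⟨n, hn⟩ := pow_unbounded_of_one_lt (64 * E ^ 2 * lam) (one_lt_two (α := ℝ))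
  have hn' : 16 * E ≤ 2 ^ n := by nlinarith [mul_le_mul hE hElam zero_le_one (by linarith)]
  have hD : 0 < Cμ ^ (n + 4) := pow_pos (one_pos.trans_le hCμ) _
  refine ⟨Cμ ^ (n + 4), 2 * (Cμ ^ (n + 4) + 8 * C * Cμ ^ 8 * (Cμ ^ (n + 4)) ^ 2),
    8 * E * lam, one_le_pow₀ hCμ, by positivity, by linarith, ?_⟩
  intro X _ _ _ _ μ hμ hP ε A hε hA
  have hconn := Discretization.graph_connected hμ hp0 hlam0 hP hε hA
  exact ⟨hconn, Discretization.finite_graphBall hμ hε hA hconn,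
    Discretization.isDoublingWith_vertexMeasure hμ hp0 hlam0 hP hε hA n hn',
    Discretization.discretePoincareWith hμ hp hlam hP hε hA n hn.le⟩
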